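/- Fix an integer $k\ge 2$ and let $\Sigma_k=\{0,1,\dots,k-1\}$. For $n\in\mathbb N_0$ let $(n)_k\in\Sigma_k^*$ be the base-$k$ expansion of $n$, most significant digit first and without leading zeros (so $(0)_k$ is the empty word); for $w\in\Sigma_k^*$ let $[w]_k$ be the integer represented by $w$. **Automata.** A $k$-automaton is a finite set $S$ with an initial state $s_0$ and a transition map $\delta:S\times\Sigma_k\to S$, extended to words by $\delta(s,vu)=\delta(\delta(s,v),u)$. It is *strongly connected* if for all $s,s'\in S$ there is a word $w$ with $\delta(s,w)=s'$, and *synchronising* if there is a word $w$ such that $\delta(s,w)$ does not depend on $s$. A sequence $a:\mathbb N_0\to\Omega$ is *$k$-automatic* (respectively *forwards synchronising $k$-automatic*) if $a(n)=\tau(\delta(s_0,(n)_k))$ for some $k$-automaton (respectively some synchronising $k$-automaton) and some map $\tau:S\to\Omega$. A $k$-automatic sequence $a$ is *strongly structured* if $a(n)=F(a_{\mathrm{per}}(n),a_{\mathrm{fs}}(n))$ for all $n$, where $a_{\mathrm{per}}$ is a periodic sequence with period coprime to $k$, $a_{\mathrm{fs}}$ is a forwards synchronising $k$-automatic sequence,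 and $F$ is a map. **Gowers norms.** For a finite abelian group $A$, $d\ge1$ and $f:A\to\mathbb C$, let $\|f\|_{U^d(A)}\geq 0$ be given by $$\|f\|_{U^d(A)}^{2^d}=\mathbb E_{n_0,\dots,n_d\in A}\ \prod_{\omega\in\{0,1\}^d}\mathcal C^{|\omega|}f\Big(n_0+\sum_{i=1}^d\omega_in_i\Big),$$ where $\mathcal C$ is complex conjugation and $|\omega|=\sum_i\omega_i$. For $N\ge1$, $[N]=\{0,\dots,N-1\}$ and $\tilde N$ the least prime larger than $2dN$, put $\|f\|_{U^d[N]}=\|1_{[N]}f\|_{U^d(\mathbb Z/\tilde N\mathbb Z)}/\|1_{[N]}\|_{U^d(\mathbb Z/\tilde N\mathbb Z)}$, where $[N]$ is identified with a subset of $\mathbb Z/\tilde N\mathbb Z$. A bounded sequence $a:\mathbb N_0\to\mathbb C$ is *highly Gowers uniform* if for every $d\ge1$ there is $c>0$ such that $\|a\|_{U^d[N]}\ll N^{-c}$ for all $N\ge1$. **Efficient group extension automata.** A group extension $k$-automaton $\mathcal T=(S,s_0,\Sigma_k,\delta,G,\lambda)$ is a $k$-automaton $(S,s_0,\Sigma_k,\delta)$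 together with a finite group $G$ and a labelling $\lambda:S\times\Sigma_k\to G$, extended to words by $\lambda(s,vu)=\lambda(s,v)\,\lambda(\delta(s,v),u)$. For $A\subseteq\mathbb N_0$ let $\gcd_k^*(A)$ be the greatest of the common divisors of $A$ that are coprime to $k$. We say that $\mathcal T$ is *efficient*, with $d'\in\mathbb N$, $g_0\in G$ and a subgroup $G_0\leq G$, if: 1. it is strongly connected; 2. it is idempotent: $\delta(s_0,0)=s_0$, $\lambda(s_0,0)=\mathrm{id}_G$, and $\delta(s,00)=\delta(s,0)$, $\lambda(s,00)=\lambda(s,0)$ for all $s\in S$; 3. it is synchronising: there is a word $w$ with $\delta(s,w)=s_0$ and $\lambda(s,w)=\mathrm{id}_G$ for all $s\in S$; 4. $\lambda(s,0)=\mathrm{id}_G$ for all $s\in S$; 5. for all $s,s'\in S$ and all sufficiently large $l$, $\{\lambda(s,w): w\in\Sigma_k^l,\ \delta(s,w)=s'\}=G$; 6. for all $s,s'\in S$ and $0\le r<d'$, $\{\lambda(s,w): w\in\Sigma_k^*,\ \delta(s,w)=s',\ [w]_k\equiv r \bmod d'\}=G_0g_0^r=g_0^rG_0$; 7. for all $s,s'\in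 S$, $g\in G_0$ and all sufficiently large $l$, $\gcd_k^*\{[w]_k: w\in\Sigma_k^l,\ \delta(s,w)=s',\ \lambda(s,w)=g\}=d'$. **Theorem.** Let $\mathcal T$ be an efficient group extension $k$-automaton, with $d'$, $g_0$, $G_0$ as above. Let $\rho:G\to\mathrm U(V)$ be an irreducible unitary representation of $G$ on a finite-dimensional complex inner product space $V$, let $\alpha:\mathrm{End}(V)\to\mathbb C$ be a linear map, let $s\in S$, and let $$b(n)=\begin{cases}\alpha\big(\rho(\lambda(s_0,(n)_k))\big)&\text{if }\delta(s_0,(n)_k)=s,\\0&\text{otherwise}\end{cases}\qquad(n\in\mathbb N_0).$$ * If $G_0\subseteq\ker\rho$, then $b$ is strongly structured. * If $G_0\not\subseteq\ker\rho$, then $b$ is highly Gowers uniform. -/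

import Mathlib

namespace AutSeq

/-! ### Base-`k` expansions

Words over the digits `Σ_k = Fin k` are lists, read from left to right, the first letter being the
most significant digit. -/

/-- `(n)_k`: the expansion of `n` in base `k`, most significant digit first, without leading zeros
(so `(0)_k` is the empty word). For `k ≥ 2` all entries of `Nat.digits k n` are less than `k`, so
`Fin.ofNat k` only changes their type. -/
def expansion (k : ℕ) [NeZero k] (n : ℕ) : List (Fin k) :=
  (Nat.digits k n).reverse.map (Fin.ofNat k)

/-- `[w]_k`: the integer represented by the word `w` in base `k` (leading zeros are allowed). -/
def wordValue (k : ℕ) (w : List (Fin k)) : ℕ :=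
  Nat.ofDigits k (w.reverse.map Fin.val)

/-! ### Automata and automatic sequences -/

/-- A `k`-automaton without output, with set of states `S`. (Finiteness of `S` is required where
automata are used.) -/
structure Automaton (k : ℕ) (S : Type*) where
  /-- the initial state `s₀` -/
  init : S
  /-- the transition function `δ` -/
  step : S → Fin k → S

namespace Automaton

variable {k : ℕ} {S : Type*}

/-- The extension `δ(s, w)` of the transition function to words. -/
def run (A : Automaton k S) (s : S) (w : List (Fin k)) : S :=
  w.foldl A.step s

/-- Any two states are joined by a path. -/
def StronglyConnected (A : Automaton k S) : Prop :=
  ∀ s s' : S, ∃ w : List (Fin k), A.run s w = s'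

/-- There is a word `w` such that `δ(s, w)` does not depend on the state `s`. -/
def Synchronising (A : Automaton k S) : Prop :=
  ∃ w : List (Fin k), ∀ s s' : S, A.run s w = A.run s' w

/-- `a(n) = τ(δ(s₀, (n)_k))` for all `n`: the sequence `a` is produced by the automaton `A` with
output function `τ`, reading the input forwards. -/
def Produces [NeZero k] {Ω : Type*} (A : Automaton k S) (τ : S → Ω) (a : ℕ → Ω) : Prop :=
  ∀ n : ℕ, a n = τ (A.run A.init (expansion k n))

end Automaton

/-- `a` is `k`-automatic: it is produced by some finite `k`-automaton with output. -/
def IsAutomatic (k : ℕ) [NeZero k] {Ω : Type*} (a : ℕ → Ω) : Prop :=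
  ∃ (S : Type) (_ : Finite S) (A : Automaton k S) (τ : S → Ω), A.Produces τ a

/-- `a` is a forwards synchronising `k`-automatic sequence: it is produced by some synchronising
finite `k`-automaton reading the input forwards. -/
def IsForwardsSynchronising (k : ℕ) [NeZero k] {Ω : Type*} (a : ℕ → Ω) : Prop :=
  ∃ (S : Type) (_ : Finite S) (A : Automaton k S) (τ : S → Ω),
    A.Synchronising ∧ A.Produces τ a

/-- `a` is strongly structured (in base `k`): it is `k`-automatic, and
`a(n) = F(a_per(n), a_fs(n))` where `a_per` is periodic with period coprime to `k` and `a_fs` is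
forwards synchronising `k`-automatic. -/
def IsStronglyStructured (k : ℕ) [NeZero k] {Ω : Type*} (a : ℕ → Ω) : Prop :=
  IsAutomatic k a ∧
  ∃ (Ωper Ωfs : Type) (aper : ℕ → Ωper) (afs : ℕ → Ωfs) (F : Ωper × Ωfs → Ω),
    (∃ p : ℕ, 0 < p ∧ p.Coprime k ∧ Function.Periodic aper p) ∧
    IsForwardsSynchronising k afs ∧
    ∀ n : ℕ, a n = F (aper n, afs n)

/-! ### Gowers norms -/

/-- The average
`𝔼_{n₀, …, n_d ∈ A} ∏_{ω ∈ {0,1}^d} 𝒞^{|ω|} f(n₀ + ω₁ n₁ + ⋯ + ω_d n_d)`,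
where `𝒞` is complex conjugation; `ω` is represented by the set `{i | ω_i = 1}`. -/
noncomputable def gowersAverage {A : Type*} [AddCommGroup A] [Fintype A] (d : ℕ) (f : A → ℂ) : ℂ :=
  (∑ n₀ : A, ∑ n : Fin d → A, ∏ ω : Finset (Fin d),
    (starRingEnd ℂ)^[ω.card] (f (n₀ + ∑ i ∈ ω, n i))) / (Fintype.card A : ℂ) ^ (d + 1)

/-- The Gowers norm `‖f‖_{U^d(A)}` on a finite abelian group, for `d ≥ 1`: the `2^d`-th root of
`gowersAverage d f`. That average is a nonnegative real number, so it equals its modulus. -/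
noncomputable def gowersNorm {A : Type*} [AddCommGroup A] [Fintype A] (d : ℕ) (f : A → ℂ) : ℝ :=
  ‖gowersAverage d f‖ ^ ((1 : ℝ) / 2 ^ d)

open Classical in
/-- `Ñ(N, d)`: the least prime larger than `2 d N`. -/
noncomputable def gowersModulus (d N : ℕ) : ℕ :=
  Nat.find (p := fun p => p.Prime ∧ 2 * d * N < p)
    (let ⟨p, hp, hp'⟩ := Nat.exists_infinite_primes (2 * d * N + 1); ⟨p, hp', hp⟩)

open Classical in
instance (d N : ℕ) : NeZero (gowersModulus d N) :=
  ⟨(Nat.find_spec (p := fun p => p.Prime ∧ 2 * d * N < p)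
    (let ⟨p, hp, hp'⟩ := Nat.exists_infinite_primes (2 * d * N + 1); ⟨p, hp', hp⟩)).1.ne_zero⟩

/-- `1_{[N]} f` as a function on `ℤ/mℤ`, where `[N] = {0, …, N - 1}`. -/
noncomputable def cutoff (N m : ℕ) (f : ℕ → ℂ) (x : ZMod m) : ℂ :=
  if x.val < N then f x.val else 0

/-- `‖f‖_{U^d[N]}`, for `d ≥ 1` and `N ≥ 1`. -/
noncomputable def gowersNormInterval (d N : ℕ) (f : ℕ → ℂ) : ℝ :=
  gowersNorm d (cutoff N (gowersModulus d N) f) /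
    gowersNorm d (cutoff N (gowersModulus d N) fun _ => 1)

/-- `a` is bounded, and for each `d ≥ 1` there is `c > 0` with `‖a‖_{U^d[N]} ≪ N^{-c}`. -/
def IsHighlyGowersUniform (a : ℕ → ℂ) : Prop :=
  (∃ B : ℝ, ∀ n, ‖a n‖ ≤ B) ∧
  ∀ d : ℕ, 1 ≤ d → ∃ c : ℝ, 0 < c ∧ ∃ C : ℝ, ∀ N : ℕ, 1 ≤ N →
    gowersNormInterval d N a ≤ C * (N : ℝ) ^ (-c)

/-! ### Group extension automata -/

/-- A group extension `k`-automaton without output: a `k`-automaton with an element of the group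
`G` attached to every transition. -/
structure GroupExtAutomaton (k : ℕ) (S G : Type*) extends Automaton k S where
  /-- the labelling `λ` -/
  label : S → Fin k → G

namespace GroupExtAutomaton

variable {k : ℕ} {S G : Type*} [Group G]

/-- The extension `λ(s, w)` of the labelling to words, so that
`λ(s, v u) = λ(s, v) * λ(δ(s, v), u)`. -/
def labelWord (T : GroupExtAutomaton k S G) : S → List (Fin k) → G
  | _, [] => 1
  | s, j :: w => T.label s j * T.labelWord (T.step s j) w

/-- `T` ignores leading zeros. -/
def Prolongable [NeZero k] (T : GroupExtAutomaton k S G) : Prop :=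
  T.step T.init 0 = T.init ∧ T.label T.init 0 = 1

/-- `T` ignores leading zeros, `δ(s, 00) = δ(s, 0)` and `λ(s, 00) = λ(s, 0)` for all `s`. -/
def Idempotent [NeZero k] (T : GroupExtAutomaton k S G) : Prop :=
  T.Prolongable ∧
  ∀ s : S, T.run s [0, 0] = T.run s [0] ∧ T.labelWord s [0, 0] = T.labelWord s [0]

/-- Some word synchronises `T` to the initial state, with trivial labels. -/
def Synchronising (T : GroupExtAutomaton k S G) : Prop :=
  ∃ w : List (Fin k), ∀ s : S, T.run s w = T.init ∧ T.labelWord s w = 1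

end GroupExtAutomaton

/-- `d = gcd_k^*(A)`: `d` is the greatest among the common divisors of the elements of `A` which
are coprime to `k`. -/
def IsGcdCoprimeTo (k : ℕ) (A : Set ℕ) (d : ℕ) : Prop :=
  IsGreatest {m : ℕ | m.Coprime k ∧ ∀ a ∈ A, m ∣ a} d

/-- The group extension automaton `T` is efficient, as witnessed by `d'`, `g₀` and `G₀`. -/
structure IsEfficient {k : ℕ} [NeZero k] {S G : Type*} [Group G] (T : GroupExtAutomaton k S G)
    (d' : ℕ) (g₀ : G) (G₀ : Subgroup G) : Prop where
  stronglyConnected : T.StronglyConnected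
  idempotent : T.Idempotent
  synchronising : T.Synchronising
  label_zero : ∀ s : S, T.label s 0 = 1
  labels_full : ∀ s s' : S, ∃ L : ℕ, ∀ l : ℕ, L ≤ l →
    {g : G | ∃ w : List (Fin k), w.length = l ∧ T.run s w = s' ∧ T.labelWord s w = g} = Set.univ
  labels_mod : ∀ s s' : S, ∀ r : ℕ, r < d' →
    {g : G | ∃ w : List (Fin k),
        T.run s w = s' ∧ wordValue k w ≡ r [MOD d'] ∧ T.labelWord s w = g}
      = (fun h => h * g₀ ^ r) '' (G₀ : Set G) ∧
    (fun h => h * g₀ ^ r) '' (G₀ : Set G) = (fun h => g₀ ^ r * h) '' (G₀ : Set G)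
  gcd_eq : ∀ s s' : S, ∀ g ∈ G₀, ∃ L : ℕ, ∀ l : ℕ, L ≤ l →
    IsGcdCoprimeTo k
      {n : ℕ | ∃ w : List (Fin k),
        w.length = l ∧ T.run s w = s' ∧ T.labelWord s w = g ∧ wordValue k w = n} d'

/-! ### Basic sequences -/

/-- The representation `ρ` is unitary: every `ρ(g)` preserves the scalar product. -/
def IsUnitaryRep {G V : Type*} [Group G] [NormedAddCommGroup V] [InnerProductSpace ℂ V]
    (ρ : Representation ℂ G V) : Prop :=
  ∀ (g : G) (v w : V), inner ℂ (ρ g v) (ρ g w) = inner ℂ v w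

open Classical in
/-- The sequence `b(n) = α(ρ(λ(s₀, (n)_k))) · 1[δ(s₀, (n)_k) = s]`. -/
noncomputable def basicSequence {k : ℕ} [NeZero k] {S G V : Type*} [Group G]
    [AddCommGroup V] [Module ℂ V] (T : GroupExtAutomaton k S G) (ρ : Representation ℂ G V)
    (α : Module.End ℂ V →ₗ[ℂ] ℂ) (s : S) (n : ℕ) : ℂ :=
  α (ρ (T.labelWord T.init (expansion k n))) *
    (if T.run T.init (expansion k n) = s then 1 else 0)

end AutSeq

open AutSeq

/-!
Let `f(n) = λ(s₀, (n)_k)`. Modulo `G₀` the label `f(n)` is determined by `n mod d'`, so if `ρ` is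
trivial on `G₀` then `b(n)` is a function of `n mod d'` and of the state reached by reading `n`
(`isStronglyStructured_basicSequence`).

Suppose that `ρ` is not trivial on `G₀`. As `G₀` is normal and `ρ` is irreducible, `∑_{h ∈ G₀} ρ(h)`
vanishes (`sum_representation_eq_zero`). The Gowers norm is an average over parallelepipeds
`n₀ + ∑_{i ∈ ω} nᵢ`, `ω ⊆ {1, …, d}`, and the cancellation comes from the following fact
(`IsEfficient.exists_cube`): for every `h ∈ G₀` there is a parallelepiped all of whose vertices lead
back to `s₀`, the vertex `ω = {1, …, d}` with label `h` and all others with label `1`. Put between a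
synchronising word and a few zeros, which absorb carries, the digits of these parallelepipeds form a
block which erases the state, stops carries, and can occur anywhere in `(n₀, …, n_d)`. Summing over
`h ∈ G₀` in such a block gives zero, so only the vectors without such blocks contribute; peeling off
blocks of digits one by one gives a bound with a power saving (`IsEfficient.exists_norm_blockSum_le`).
The highest digits and the cutoff at `N` are dealt with by splitting `[N]` into intervals of length
about `√N` (`norm_cubeSum_basicSequence_le`).

To find the parallelepipeds, consider the group of all label tuples of parallelepipeds with vertices
leading back to `s₀` (`cubeGroup`; the product is concatenation of words), and let `H_d ≤ G` consist
of the labels that can occur at the last vertex with `1` elsewhere (`vertexGroup`). Each `H_d` is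
normal, `H_1 = G`, and `[G, H_d] ≤ H_{d+1}`. If `G₀ ≤ H_d`, then `G₀` is central modulo `H_{d+1}`,
and since `G / G₀` is cyclic, `A = G / H_{d+1}` is abelian. Dividing a tuple by its degenerations
shows that `H_{d+1}` contains all `(d+1)`-fold differences of `f` (`iterDeriv_mem_vertexGroup`), so
`f` is a polynomial of degree at most `d` with values in `A`. Because it is synchronising and
satisfies `f(kn) = f(n)`, it has to be linear (`eq_nsmul_of_iterDiff_eq_zero`): `f(n) = c ^ n`, where
`c ^ (k - 1) = 1`. The order of `c` is thus coprime to `k` and divides every `n` with `f(n) = 1`, hence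
it divides `d'`; and as every element of `G₀` is a label `f(n)` with `d' ∣ n`, the group `G₀` is trivial
in `A`, that is, `G₀ ≤ H_{d+1}` (`IsEfficient.le_vertexGroup`).
-/

namespace AutSeq

/-! ### Words of prescribed length and values of an automaton at integers -/

/-- The word formed by the `L` least significant base-`k` digits of `x`, padded with leading zeros
if `x < k ^ (L - 1)`. -/
def word (k : ℕ) [NeZero k] : ℕ → ℕ → List (Fin k)
  | 0, _ => []
  | L + 1, x => word k L (x / k) ++ [Fin.ofNat k x]

theorem wordValue_nil {k : ℕ} : wordValue k [] = 0 := rfl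

theorem wordValue_append_singleton {k : ℕ} (w : List (Fin k)) (a : Fin k) :
    wordValue k (w ++ [a]) = wordValue k w * k + a := by
  simp [wordValue, Nat.ofDigits_cons, mul_comm, add_comm]

theorem wordValue_lt {k : ℕ} (w : List (Fin k)) : wordValue k w < k ^ w.length := by
  induction w using List.reverseRecOn with
  | nil => simp [wordValue_nil]
  | append_singleton w a ih =>
    rw [wordValue_append_singleton, List.length_append, List.length_singleton, pow_succ]
    calc wordValue k w * k + a < wordValue k w * k + k := by have := a.2; omega
      _ = (wordValue k w + 1) * k := by ring
      _ ≤ k ^ w.length * k := Nat.mul_le_mul_right _ ih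

section Words

variable {k : ℕ} [NeZero k]

theorem word_add (L M x : ℕ) : word k (L + M) x = word k L (x / k ^ M) ++ word k M x := by
  induction M generalizing x with
  | zero => simp [word]
  | succ M ih =>
    rw [← Nat.add_assoc, word, ih, word, Nat.div_div_eq_div_mul, pow_succ', List.append_assoc]

theorem word_mul_pow_add (L q x : ℕ) : word k L (q * k ^ L + x) = word k L x := by
  induction L generalizing x with
  | zero => rfl
  | succ L ih =>
    have hk : 0 < k := Nat.pos_of_ne_zero (NeZero.ne k)
    have h1 : (q * k ^ (L + 1) + x) / k = q * k ^ L + x / k := by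
      rw [pow_succ, ← mul_assoc, Nat.add_comm, Nat.add_mul_div_right _ _ hk, Nat.add_comm]
    have h2 : Fin.ofNat k (q * k ^ (L + 1) + x) = Fin.ofNat k x := by
      apply Fin.ext
      simp [Fin.ofNat, pow_succ, ← mul_assoc]
    rw [word, word, h1, ih, h2]

theorem word_wordValue (w : List (Fin k)) : word k w.length (wordValue k w) = w := by
  induction w using List.reverseRecOn with
  | nil => rfl
  | append_singleton w a ih =>
    have hk : 0 < k := Nat.pos_of_ne_zero (NeZero.ne k)
    rw [wordValue_append_singleton, List.length_append, List.length_singleton, word]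
    have h1 : (wordValue k w * k + a) / k = wordValue k w := by
      rw [Nat.add_comm, Nat.add_mul_div_right _ _ hk, Nat.div_eq_of_lt a.2, zero_add]
    have h2 : Fin.ofNat k (wordValue k w * k + a) = a := by
      apply Fin.ext
      simp [Fin.ofNat, Nat.mod_eq_of_lt a.2]
    rw [h1, ih, h2]

theorem expansion_zero : expansion k 0 = [] := by simp [expansion]

theorem expansion_of_pos (hk : 2 ≤ k) {n : ℕ} (hn : 0 < n) :
    expansion k n = expansion k (n / k) ++ [Fin.ofNat k n] := by
  have h : Fin.ofNat k (n % k) = Fin.ofNat k n := by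
    apply Fin.ext
    simp [Fin.ofNat]
  rw [expansion, expansion, Nat.digits_def' hk hn]
  simpa using h

theorem wordValue_expansion (hk : 2 ≤ k) (n : ℕ) : wordValue k (expansion k n) = n := by
  induction n using Nat.strong_induction_on with
  | _ n ih =>
    rcases Nat.eq_zero_or_pos n with rfl | hn
    · rw [expansion_zero, wordValue_nil]
    · rw [expansion_of_pos hk hn, wordValue_append_singleton, ih _ (Nat.div_lt_self hn hk)]
      simp only [Fin.ofNat]
      rw [mul_comm]
      exact Nat.div_add_mod n k

end Words

theorem Automaton.run_append {k : ℕ} {S : Type*} (A : Automaton k S) (s : S)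
    (u v : List (Fin k)) : A.run s (u ++ v) = A.run (A.run s u) v := by
  simp [Automaton.run]

namespace GroupExtAutomaton

/-- The state `δ(s₀, (n)_k)` reached after reading the integer `n`. -/
def stateAt {k : ℕ} [NeZero k] {S G : Type*} (T : GroupExtAutomaton k S G) (n : ℕ) : S := T.run T.init (expansion k n)

theorem stateAt_zero {k : ℕ} [NeZero k] {S G : Type*} (T : GroupExtAutomaton k S G) :
    T.stateAt 0 = T.init := by
  simp [stateAt, expansion_zero, Automaton.run]

variable {k : ℕ} {S G : Type*} [Group G] (T : GroupExtAutomaton k S G)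

theorem labelWord_append (s : S) (u v : List (Fin k)) :
    T.labelWord s (u ++ v) = T.labelWord s u * T.labelWord (T.run s u) v := by
  induction u generalizing s with
  | nil => simp [labelWord, Automaton.run]
  | cons j u ih =>
    simp only [List.cons_append, labelWord, ih, mul_assoc]
    rfl

variable [NeZero k]

/-- The label `λ(s₀, (n)_k)` of the integer `n`. -/
def labelAt (n : ℕ) : G := T.labelWord T.init (expansion k n)

theorem labelAt_zero : T.labelAt 0 = 1 := by
  simp [labelAt, expansion_zero, labelWord]

variable {T}

theorem run_init_word_and_labelWord_init_word (hk : 2 ≤ k) (hT : T.Prolongable) {L n : ℕ}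
    (hn : n < k ^ L) :
    T.run T.init (word k L n) = T.stateAt n ∧ T.labelWord T.init (word k L n) = T.labelAt n := by
  induction L generalizing n with
  | zero =>
    obtain rfl : n = 0 := by simpa using hn
    exact ⟨T.stateAt_zero.symm, T.labelAt_zero.symm⟩
  | succ L ih =>
    obtain ⟨h1, h2⟩ := ih (n := n / k) (Nat.div_lt_of_lt_mul (by rwa [pow_succ'] at hn))
    rw [word, Automaton.run_append, labelWord_append, h1, h2]
    rcases Nat.eq_zero_or_pos n with rfl | hpos
    · have h0 : Fin.ofNat k 0 = 0 := rfl
      rw [Nat.zero_div, stateAt_zero, labelAt_zero, h0]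
      exact ⟨hT.1, by simp [labelWord, hT.2]⟩
    · simp only [stateAt, labelAt]
      rw [expansion_of_pos hk hpos, Automaton.run_append, labelWord_append]
      exact ⟨rfl, rfl⟩

theorem stateAt_mul_pow_add (hk : 2 ≤ k) (hT : T.Prolongable) (x : ℕ) {M y : ℕ}
    (hy : y < k ^ M) : T.stateAt (x * k ^ M + y) = T.run (T.stateAt x) (word k M y) := by
  have hx : x < k ^ x := Nat.lt_pow_self hk
  have hlt : x * k ^ M + y < k ^ (x + M) := by
    rw [pow_add]; nlinarith
  have hd : (x * k ^ M + y) / k ^ M = x := by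
    rw [Nat.add_comm, Nat.add_mul_div_right _ _ (by positivity), Nat.div_eq_of_lt hy, zero_add]
  rw [← (run_init_word_and_labelWord_init_word hk hT hlt).1, word_add, hd, word_mul_pow_add,
    Automaton.run_append, (run_init_word_and_labelWord_init_word hk hT hx).1]

theorem labelAt_mul_pow_add (hk : 2 ≤ k) (hT : T.Prolongable) (x : ℕ) {M y : ℕ}
    (hy : y < k ^ M) :
    T.labelAt (x * k ^ M + y) = T.labelAt x * T.labelWord (T.stateAt x) (word k M y) := by
  have hx : x < k ^ x := Nat.lt_pow_self hk
  have hlt : x * k ^ M + y < k ^ (x + M) := by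
    rw [pow_add]; nlinarith
  have hd : (x * k ^ M + y) / k ^ M = x := by
    rw [Nat.add_comm, Nat.add_mul_div_right _ _ (by positivity), Nat.div_eq_of_lt hy, zero_add]
  rw [← (run_init_word_and_labelWord_init_word hk hT hlt).2, word_add, hd, word_mul_pow_add,
    labelWord_append, (run_init_word_and_labelWord_init_word hk hT hx).1,
    (run_init_word_and_labelWord_init_word hk hT hx).2]

theorem labelAt_wordValue (hk : 2 ≤ k) (hT : T.Prolongable) (w : List (Fin k)) :
    T.labelAt (wordValue k w) = T.labelWord T.init w := by
  rw [← (run_init_word_and_labelWord_init_word hk hT (wordValue_lt w)).2, word_wordValue]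

/-- As `λ(s, 0) = 1`, trailing zeros do not change the label. -/
theorem labelAt_mul_base (hk : 2 ≤ k) (hT : T.Prolongable) (h0 : ∀ s, T.label s 0 = 1) (n : ℕ) :
    T.labelAt (k * n) = T.labelAt n := by
  have h := labelAt_mul_pow_add hk hT n (M := 1) (y := 0) (by simp; omega)
  have hw : word k 1 0 = [0] := rfl
  rw [hw] at h
  simpa [mul_comm, labelWord, h0] using h

end GroupExtAutomaton

/-! ### The residue of an integer determines its label modulo `G₀` -/

section Structured

variable {k : ℕ} [NeZero k] {S G : Type*} [Group G] {T : GroupExtAutomaton k S G}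
  {d' : ℕ} {g₀ : G} {G₀ : Subgroup G}

theorem IsEfficient.coprime (hT : IsEfficient T d' g₀ G₀) : d'.Coprime k := by
  obtain ⟨L, hL⟩ := hT.gcd_eq T.init T.init 1 G₀.one_mem
  exact (hL L le_rfl).1.1

theorem IsEfficient.pos (hk : 2 ≤ k) (hT : IsEfficient T d' g₀ G₀) : 0 < d' := by
  rcases Nat.eq_zero_or_pos d' with h | h
  · have := hT.coprime
    rw [h, Nat.coprime_zero_left] at this
    omega
  · exact h

theorem IsEfficient.exists_labelWord_eq (hk : 2 ≤ k) (hT : IsEfficient T d' g₀ G₀)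
    (w : List (Fin k)) :
    ∃ h ∈ G₀, T.labelWord T.init w = h * g₀ ^ (wordValue k w % d') := by
  have hm := (hT.labels_mod T.init (T.run T.init w) _ (Nat.mod_lt (wordValue k w) (hT.pos hk))).1
  have : T.labelWord T.init w ∈ (fun h => h * g₀ ^ (wordValue k w % d')) '' (G₀ : Set G) := by
    rw [← hm]
    exact ⟨w, rfl, (Nat.mod_modEq _ _).symm, rfl⟩
  obtain ⟨h, hh, e⟩ := this
  exact ⟨h, hh, e.symm⟩

theorem IsEfficient.exists_labelAt_eq (hk : 2 ≤ k) (hT : IsEfficient T d' g₀ G₀) (g : G) :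
    ∃ n, T.labelAt n = g := by
  obtain ⟨L, hL⟩ := hT.labels_full T.init T.init
  obtain ⟨w, -, -, rfl⟩ : g ∈ {g : G | ∃ w : List (Fin k), w.length = L ∧
      T.run T.init w = T.init ∧ T.labelWord T.init w = g} := by
    rw [hL L le_rfl]; trivial
  exact ⟨_, GroupExtAutomaton.labelAt_wordValue hk hT.idempotent.1 w⟩

/-- As every element of `G` is the label of an integer, `G` is generated by `G₀`
and `g₀`. -/
theorem IsEfficient.exists_eq_mul_pow (hk : 2 ≤ k) (hT : IsEfficient T d' g₀ G₀) (g : G) :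
    ∃ h ∈ G₀, ∃ r < d', g = h * g₀ ^ r := by
  obtain ⟨n, rfl⟩ := hT.exists_labelAt_eq hk g
  obtain ⟨h, hh, e⟩ := hT.exists_labelWord_eq hk (expansion k n)
  exact ⟨h, hh, _, Nat.mod_lt _ (hT.pos hk), e⟩

theorem IsEfficient.normal (hk : 2 ≤ k) (hT : IsEfficient T d' g₀ G₀) : G₀.Normal := by
  refine ⟨fun n hn g => ?_⟩
  obtain ⟨h, hh, r, hr, rfl⟩ := hT.exists_eq_mul_pow hk g
  have hcomm := (hT.labels_mod T.init T.init r hr).2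
  have : g₀ ^ r * n ∈ (fun h => h * g₀ ^ r) '' (G₀ : Set G) := by
    rw [hcomm]; exact ⟨n, hn, rfl⟩
  obtain ⟨n', hn', e⟩ := this
  have e' : h * g₀ ^ r * n * (h * g₀ ^ r)⁻¹ = h * n' * h⁻¹ := by
    rw [mul_assoc h, ← e]; group
  rw [e']
  exact G₀.mul_mem (G₀.mul_mem hh hn') (G₀.inv_mem hh)

variable [Finite S] [Finite G]

theorem isStronglyStructured_basicSequence (hk : 2 ≤ k) (hT : IsEfficient T d' g₀ G₀)
    {V : Type*} [AddCommGroup V] [Module ℂ V] (ρ : Representation ℂ G V)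
    (α : Module.End ℂ V →ₗ[ℂ] ℂ) (s : S) (hker : G₀ ≤ MonoidHom.ker ρ) :
    IsStronglyStructured k (basicSequence T ρ α s) := by
  classical
  -- States live in an arbitrary universe; they are transported to an initial segment of `ℕ`.
  obtain ⟨m, ⟨e⟩⟩ := Finite.exists_equiv_fin S
  obtain ⟨m₂, ⟨e₂⟩⟩ := Finite.exists_equiv_fin (S × G)
  constructor
  · let A : Automaton k (Fin m₂) :=
      ⟨e₂ (T.init, 1), fun x j => e₂ (T.step (e₂.symm x).1 j,
        (e₂.symm x).2 * T.label (e₂.symm x).1 j)⟩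
    have hrun : ∀ (w : List (Fin k)) (t : S) (g : G),
        A.run (e₂ (t, g)) w = e₂ (T.run t w, g * T.labelWord t w) := by
      intro w
      induction w with
      | nil => intro t g; simp [Automaton.run, GroupExtAutomaton.labelWord]
      | cons j w ih =>
        intro t g
        have h1 : A.run (e₂ (t, g)) (j :: w) = A.run (A.step (e₂ (t, g)) j) w := rfl
        have h2 : A.step (e₂ (t, g)) j = e₂ (T.step t j, g * T.label t j) := by simp [A]
        rw [h1, h2, ih]
        simp [GroupExtAutomaton.labelWord, Automaton.run, mul_assoc]
    refine ⟨Fin m₂, inferInstance, A,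
      fun x => α (ρ (e₂.symm x).2) * (if (e₂.symm x).1 = s then 1 else 0), fun n => ?_⟩
    have : A.init = e₂ (T.init, 1) := rfl
    rw [this, hrun]
    simp [basicSequence]
  · let A : Automaton k (Fin m) := ⟨e T.init, fun x j => e (T.step (e.symm x) j)⟩
    have hrun : ∀ (w : List (Fin k)) (x : Fin m), A.run x w = e (T.run (e.symm x) w) := by
      intro w
      induction w with
      | nil => intro x; simp [Automaton.run]
      | cons j w ih =>
        intro x
        have h1 : A.run x (j :: w) = A.run (A.step x j) w := rfl
        rw [h1, ih]
        simp [A, Automaton.run]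
    refine ⟨ℕ, Fin m, fun n => n % d', fun n => e (T.stateAt n),
      fun p => α (ρ (g₀ ^ p.1)) * (if e.symm p.2 = s then 1 else 0),
      ⟨d', hT.pos hk, hT.coprime, fun n => by simp⟩,
      ⟨Fin m, inferInstance, A, id, ?_, fun n => ?_⟩, fun n => ?_⟩
    · obtain ⟨w, hw⟩ := hT.synchronising
      exact ⟨w, fun x y => by rw [hrun, hrun, (hw _).1, (hw _).1]⟩
    · have : A.init = e T.init := rfl
      rw [this, hrun]
      simp [GroupExtAutomaton.stateAt]
    · obtain ⟨h, hh, hl⟩ := hT.exists_labelWord_eq hk (expansion k n)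
      rw [wordValue_expansion hk] at hl
      have h1 : ρ h = 1 := hker hh
      simp [basicSequence, hl, h1, GroupExtAutomaton.stateAt]

end Structured

/-! ### Iterated differences of synchronising functions with values in an abelian group -/

section Differences

variable {A : Type*} [AddCommGroup A]

/-- The iterated difference of `f` with steps the entries of a list, the head of the list being
the step of the innermost difference. -/
def iterDiff : List ℕ → (ℕ → A) → ℕ → A
  | [], f => f
  | a :: l, f => iterDiff l fun x => f (x + a) - f x

theorem iterDiff_zero (l : List ℕ) : iterDiff l (0 : ℕ → A) = 0 := by
  induction l with
  | nil => rfl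
  | cons a l ih =>
    rw [iterDiff]
    convert ih using 2
    funext x
    simp

theorem iterDiff_add (l : List ℕ) (f g : ℕ → A) (x : ℕ) :
    iterDiff l (fun y => f y + g y) x = iterDiff l f x + iterDiff l g x := by
  induction l generalizing f g with
  | nil => rfl
  | cons a l ih =>
    rw [iterDiff, iterDiff, iterDiff, ← ih]
    congr 1
    funext y
    abel

theorem iterDiff_shift (l : List ℕ) (f : ℕ → A) (b x : ℕ) :
    iterDiff l (fun y => f (y + b)) x = iterDiff l f (x + b) := by
  induction l generalizing f with
  | nil => rfl
  | cons a l ih =>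
    rw [iterDiff, iterDiff, ← ih]
    simp only [add_right_comm]

theorem iterDiff_append_singleton (l : List ℕ) (a : ℕ) (f : ℕ → A) (x : ℕ) :
    iterDiff (l ++ [a]) f x = iterDiff l f (x + a) - iterDiff l f x := by
  induction l generalizing f with
  | nil => rfl
  | cons b l ih => rw [List.cons_append, iterDiff, ih]; rfl

/-- An iterated difference depends only on the values between the base point and the sum of the
base point and all the steps. -/
theorem iterDiff_congr (l : List ℕ) {f g : ℕ → A} {x : ℕ}
    (h : ∀ y ≤ l.sum, f (x + y) = g (x + y)) : iterDiff l f x = iterDiff l g x := by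
  induction l generalizing f g with
  | nil => simpa [iterDiff] using h 0
  | cons a l ih =>
    apply ih
    intro y hy
    have h1 := h (y + a) (by rw [List.sum_cons]; omega)
    have h2 := h y (by rw [List.sum_cons]; omega)
    rw [add_assoc, h1, h2]

theorem iterDiff_map_mul (k : ℕ) (l : List ℕ) (f : ℕ → A) (x : ℕ) :
    iterDiff (l.map (k * ·)) f (k * x) = iterDiff l (fun y => f (k * y)) x := by
  induction l generalizing f with
  | nil => rfl
  | cons a l ih =>
    rw [List.map_cons, iterDiff, ih, iterDiff]
    simp only [mul_add]

/-- In a finite group the elements killed by some power of `k` are killed by a common power. -/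
theorem exists_pow_smul_eq_zero [Finite A] (k : ℕ) :
    ∃ E : ℕ, ∀ (y : A) (m : ℕ), k ^ m • y = 0 → k ^ E • y = 0 := by
  obtain ⟨a, b, hab, h⟩ := Finite.exists_ne_map_eq_of_infinite fun (j : ℕ) (y : A) => k ^ j • y
  wlog hlt : a < b generalizing a b
  · exact this b a hab.symm h.symm (by omega)
  refine ⟨a, fun y m hm => ?_⟩
  have hstep : ∀ i : ℕ, k ^ a • y = k ^ (a + i * (b - a)) • y := by
    intro i
    induction i with
    | zero => simp
    | succ i ih =>
      have e : a + (i + 1) * (b - a) = i * (b - a) + b := by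
        rw [Nat.succ_mul]; omega
      have hb : k ^ b • y = k ^ a • y := (congrFun h y).symm
      rw [e, pow_add, mul_smul, hb, ← mul_smul, ← pow_add, add_comm, ih]
  have hle : m ≤ a + m * (b - a) :=
    le_trans (Nat.le_mul_of_pos_right m (by omega)) (Nat.le_add_left _ _)
  rw [hstep m, ← Nat.sub_add_cancel hle, pow_add, mul_smul, hm, smul_zero]

variable {k : ℕ} {f : ℕ → A}

theorem iterDiff_cons_nsmul (l : List ℕ) (h : ∀ a x y, iterDiff (a :: l) f x = iterDiff (a :: l) f y)
    (c a : ℕ) : iterDiff ((c * a) :: l) f 0 = c • iterDiff (a :: l) f 0 := by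
  induction c with
  | zero =>
    have e : (fun x => f (x + 0) - f x) = 0 := by funext x; simp
    rw [zero_mul, zero_smul, iterDiff, e, iterDiff_zero]
    rfl
  | succ c ih =>
    have : iterDiff (((c + 1) * a) :: l) f 0 =
        iterDiff ((c * a) :: l) f (0 + a) + iterDiff (a :: l) f 0 := by
      rw [iterDiff, iterDiff, iterDiff, ← iterDiff_shift, ← iterDiff_add]
      congr 1
      funext x
      rw [add_mul, one_mul, add_comm (c * a) a, add_assoc]
      abel
    rw [this, h _ (0 + a) 0, ih, succ_nsmul]

/-- A base-`k` synchronising function: inserting the digits of `z` (a word of length `w`) separates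
the contributions of the digits in front of them from those behind them. -/
def SplitsAt (k w z : ℕ) (f : ℕ → A) : Prop :=
  ∀ β x y : ℕ, y < k ^ β → f (x * k ^ (w + β) + z * k ^ β + y) = f x + f y

/-- A step far above the synchronising word contributes a constant to the difference, so that
one further difference vanishes. -/
theorem SplitsAt.exists_iterDiff_eq_zero {w z : ℕ} (hk : 2 ≤ k) (hf : SplitsAt k w z f)
    (l : List ℕ) (hl : l ≠ []) :
    ∃ L, ∀ x, ∃ n, iterDiff ((k ^ L * x) :: l) f n = 0 := by
  have hβ : l.sum < k ^ l.sum := Nat.lt_pow_self hk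
  set β := l.sum with hβdef
  refine ⟨w + β, fun x => ⟨z * k ^ β, ?_⟩⟩
  obtain ⟨a, l', rfl⟩ := List.exists_cons_of_ne_nil hl
  have h1 : ∀ y ≤ β, f (z * k ^ β + y + k ^ (w + β) * x) - f (z * k ^ β + y) = f x - f 0 := by
    intro y hy
    have e1 := hf β x y (by omega)
    have e2 := hf β 0 y (by omega)
    rw [zero_mul, zero_add] at e2
    rw [e2, add_comm, ← add_assoc, mul_comm, e1]
    abel
  rw [iterDiff, iterDiff_congr _ (g := fun _ => f x - f 0) h1, iterDiff]
  simp only [sub_self]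
  exact congrFun (iterDiff_zero l') _

/-- The order of vanishing differences can be lowered as long as it exceeds `2`. A difference of the
top order does not depend on the base point and is additive in its first step. It is invariant under
multiplying all steps by `k`, and it is killed by a power of `k`, since it vanishes when the first
step is far above the others. -/
theorem iterDiff_descent [Finite A] {w z : ℕ} (hk : 2 ≤ k) (hf : SplitsAt k w z f)
    (hfk : ∀ n, f (k * n) = f n) {d : ℕ}
    (h : ∀ l : List ℕ, l.length = d + 3 → ∀ x, iterDiff l f x = 0) :
    ∀ l : List ℕ, l.length = d + 2 → ∀ x, iterDiff l f x = 0 := by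
  have hconst : ∀ l : List ℕ, l.length = d + 2 → ∀ x, iterDiff l f x = iterDiff l f 0 := by
    intro l hl x
    have := h (l ++ [x]) (by simp [hl]) 0
    rw [iterDiff_append_singleton, zero_add] at this
    exact sub_eq_zero.mp this
  -- Every top-order difference is killed by a power of `k`.
  have htors : ∀ (a : ℕ) (l : List ℕ), l.length = d + 1 →
      ∃ L, k ^ L • iterDiff (a :: l) f 0 = 0 := by
    intro a l hl
    obtain ⟨L, hL⟩ := hf.exists_iterDiff_eq_zero hk l (by rintro rfl; simp at hl)
    obtain ⟨n, hn⟩ := hL a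
    refine ⟨L, ?_⟩
    rw [← iterDiff_cons_nsmul l (fun b x y => by
      rw [hconst _ (by simp [hl]) x, hconst _ (by simp [hl]) y]), ← hconst _ (by simp [hl]) n, hn]
  have hscale : ∀ (j : ℕ) (l : List ℕ),
      iterDiff (l.map (k ^ j * ·)) f 0 = iterDiff l f 0 := by
    intro j l
    have hfj : ∀ n, f (k ^ j * n) = f n := by
      intro n
      induction j with
      | zero => simp
      | succ j ih => rw [pow_succ', mul_assoc, hfk, ih]
    have := iterDiff_map_mul (k ^ j) l f 0
    rw [mul_zero] at this
    rw [this]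
    simp only [hfj]
  obtain ⟨E, hE⟩ := exists_pow_smul_eq_zero (A := A) k
  intro l hl x
  rw [hconst l hl]
  obtain ⟨a, l, rfl⟩ := List.exists_cons_of_ne_nil (l := l) (by rintro rfl; simp at hl)
  have hl' : l.length = d + 1 := by simpa using hl
  have hlm : (l.map (k ^ E * ·)).length = d + 1 := by simpa using hl'
  obtain ⟨L, hL⟩ := htors a _ hlm
  rw [← hscale E, List.map_cons, iterDiff_cons_nsmul _ fun b x y => by
    rw [hconst _ (by simp [hl']) x, hconst _ (by simp [hl']) y]]
  exact hE _ _ hL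

/-- A synchronising function that ignores trailing zeros and is a polynomial (some iterated
difference vanishes) is linear. -/
theorem eq_nsmul_of_iterDiff_eq_zero [Finite A] {w z : ℕ} (hk : 2 ≤ k) (hf : SplitsAt k w z f)
    (hfk : ∀ n, f (k * n) = f n) (hf0 : f 0 = 0) (d : ℕ)
    (h : ∀ l : List ℕ, l.length = d + 2 → ∀ x, iterDiff l f x = 0) (n : ℕ) : f n = n • f 1 := by
  have h2 : ∀ l : List ℕ, l.length = 2 → ∀ x, iterDiff l f x = 0 := by
    induction d with
    | zero => exact h
    | succ d ih => exact ih (iterDiff_descent hk hf hfk h)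
  induction n with
  | zero => simp [hf0]
  | succ n ih =>
    have := h2 [n, 1] rfl 0
    simp only [iterDiff, zero_add, hf0, sub_zero] at this
    rw [add_comm 1 n, sub_sub, sub_eq_zero] at this
    rw [this, ih, succ_nsmul, add_comm]

end Differences

/-! ### The group of label cubes -/

open scoped commutatorElement

/-- The vertex `n₀ + ∑_{i ∈ ω} nᵢ` of a parallelepiped. -/
def cubeValue {ι : Type*} (n₀ : ℕ) (n : ι → ℕ) (ω : Finset ι) : ℕ := n₀ + ∑ i ∈ ω, n i

theorem cubeValue_mul_add {ι : Type*} (m₀ n₀ c : ℕ) (m n : ι → ℕ) (ω : Finset ι) :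
    cubeValue (m₀ * c + n₀) (fun i => m i * c + n i) ω = cubeValue m₀ m ω * c + cubeValue n₀ n ω := by
  simp only [cubeValue, Finset.sum_add_distrib, ← Finset.sum_mul]
  ring

theorem cubeValue_le {n₀ : ℕ} {n : ℕ → ℕ} {D : ℕ} (hD : ∀ i, D ≤ i → n i = 0) (ω : Finset ℕ) :
    cubeValue n₀ n ω ≤ n₀ + ∑ i ∈ Finset.range D, n i := by
  refine Nat.add_le_add_left ?_ _
  rw [← Finset.sum_filter_add_sum_filter_not ω (· < D), Finset.sum_eq_zero (s := {i ∈ ω | ¬ i < D}),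
    add_zero]
  · exact Finset.sum_le_sum_of_subset fun i hi => by simpa using (Finset.mem_filter.mp hi).2
  · intro i hi
    exact hD i (not_lt.mp (Finset.mem_filter.mp hi).2)

/-- The element of `G ^ {ω}` equal to `h` on the upper face `{ω | I ⊆ ω}` of the cube and to `1`
elsewhere. -/
def face {G : Type*} [Group G] (I : Finset ℕ) : G →* (Finset ℕ → G) where
  toFun h ω := if I ⊆ ω then h else 1
  map_one' := by funext ω; simp
  map_mul' g h := by funext ω; by_cases hI : I ⊆ ω <;> simp [hI]

theorem face_apply {G : Type*} [Group G] (I : Finset ℕ) (h : G) (ω : Finset ℕ) :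
    face I h ω = if I ⊆ ω then h else 1 := rfl

theorem face_commutator {G : Type*} [Group G] (I J : Finset ℕ) (g h : G) :
    ⁅face I g, face J h⁆ = face (I ∪ J) ⁅g, h⁆ := by
  funext ω
  by_cases hI : I ⊆ ω <;> by_cases hJ : J ⊆ ω <;>
    simp [face_apply, hI, hJ, Finset.union_subset_iff, commutatorElement_def]

/-- The iterated difference `(x, n) ↦ D_{n₀} ⋯ D_{n_{j-1}} f (x)` of a function with values in a
group, where `D_n f (x) = f(x)⁻¹ f(x + n)`. -/
def iterDeriv {G : Type*} [Group G] (f : ℕ → G) (n : ℕ → ℕ) : ℕ → ℕ → G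
  | 0, x => f x
  | j + 1, x => (iterDeriv f n j x)⁻¹ * iterDeriv f n j (x + n j)

theorem iterDeriv_congr {G : Type*} [Group G] (f : ℕ → G) {n n' : ℕ → ℕ} {j : ℕ}
    (h : ∀ i < j, n i = n' i) (x : ℕ) : iterDeriv f n j x = iterDeriv f n' j x := by
  induction j generalizing x with
  | zero => rfl
  | succ j ih =>
    have ih' := ih fun i hi => h i (by omega)
    rw [iterDeriv, iterDeriv, ih', ih', h j (by omega)]

theorem ofMul_map_iterDeriv {G A : Type*} [Group G] [CommGroup A] (π : G →* A) (f : ℕ → G)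
    (n : ℕ → ℕ) (j x : ℕ) : Additive.ofMul (π (iterDeriv f n j x)) =
      iterDiff ((List.range j).map n) (fun y => Additive.ofMul (π (f y))) x := by
  induction j generalizing x with
  | zero => rfl
  | succ j ih =>
    rw [List.range_succ, List.map_append, List.map_singleton, iterDiff_append_singleton, iterDeriv,
      ← ih, ← ih, map_mul, map_inv, ofMul_mul, ofMul_inv]
    abel

section CubeGroup

variable {k : ℕ} [NeZero k] {S G : Type*} [Group G] {T : GroupExtAutomaton k S G}

/-- The tuples of labels on the vertices of a parallelepiped all of whose vertices lead back to the
initial state. Cubes of all dimensions are treated together: the vertices are indexed by finite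
sets of natural numbers, and all but finitely many edges are degenerate. -/
def cubeMonoid (hk : 2 ≤ k) (hT : T.Prolongable) : Submonoid (Finset ℕ → G) where
  carrier := {g | ∃ (n₀ : ℕ) (n : ℕ → ℕ), (∃ D, ∀ i, D ≤ i → n i = 0) ∧
    ∀ ω, T.stateAt (cubeValue n₀ n ω) = T.init ∧ T.labelAt (cubeValue n₀ n ω) = g ω}
  one_mem' := ⟨0, fun _ => 0, ⟨0, fun _ _ => rfl⟩, fun ω => by
    simp [cubeValue, T.stateAt_zero, T.labelAt_zero]⟩
  mul_mem' := by
    rintro g h ⟨m₀, m, ⟨D, hD⟩, hm⟩ ⟨n₀, n, ⟨E, hE⟩, hn⟩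
    -- Concatenation of words corresponds to multiplication of labels.
    set L := n₀ + ∑ i ∈ Finset.range E, n i
    have hL : ∀ ω, cubeValue n₀ n ω < k ^ L := fun ω =>
      (cubeValue_le hE ω).trans_lt (Nat.lt_pow_self hk)
    refine ⟨m₀ * k ^ L + n₀, fun i => m i * k ^ L + n i,
      ⟨max D E, fun i hi => by simp [hD i (by omega), hE i (by omega)]⟩, fun ω => ?_⟩
    obtain ⟨h1, h2⟩ := GroupExtAutomaton.run_init_word_and_labelWord_init_word hk hT (hL ω)
    rw [cubeValue_mul_add, GroupExtAutomaton.stateAt_mul_pow_add hk hT _ (hL ω),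
      GroupExtAutomaton.labelAt_mul_pow_add hk hT _ (hL ω), (hm ω).1, (hm ω).2, h1, h2, (hn ω).1,
      (hn ω).2]
    exact ⟨rfl, rfl⟩

/-- `cubeMonoid` is a group, because every element of it has finite order. -/
def cubeGroup [Finite G] (hk : 2 ≤ k) (hT : T.Prolongable) : Subgroup (Finset ℕ → G) where
  toSubmonoid := cubeMonoid hk hT
  inv_mem' := by
    intro g hg
    have h1 : g ^ Nat.card G = 1 := by
      funext ω
      exact pow_card_eq_one'
    have h2 : g⁻¹ = g ^ (Nat.card G - 1) := by
      rw [inv_eq_iff_mul_eq_one, ← pow_succ', Nat.sub_add_cancel Nat.card_pos, h1]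
    rw [h2]
    exact (cubeMonoid hk hT).pow_mem hg _

variable [Finite G] (hk : 2 ≤ k) (hT : T.Prolongable)

/-- Appending a synchronising word to all vertices brings them back to the initial state. -/
theorem labelAt_cubeValue_mem_cubeGroup (hsync : T.Synchronising) (n₀ : ℕ) (n : ℕ → ℕ) (D : ℕ)
    (hD : ∀ i, D ≤ i → n i = 0) :
    (fun ω => T.labelAt (cubeValue n₀ n ω)) ∈ cubeGroup hk hT := by
  obtain ⟨W, hW⟩ := hsync
  have hlt := wordValue_lt W
  refine ⟨n₀ * k ^ W.length + wordValue k W, fun i => n i * k ^ W.length + 0,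
    ⟨D, fun i hi => by simp [hD i hi]⟩, fun ω => ?_⟩
  have h0 : cubeValue (wordValue k W) (fun _ : ℕ => 0) ω = wordValue k W := by simp [cubeValue]
  rw [cubeValue_mul_add n₀ (wordValue k W) (k ^ W.length) n (fun _ => 0), h0,
    GroupExtAutomaton.stateAt_mul_pow_add hk hT _ hlt,
    GroupExtAutomaton.labelAt_mul_pow_add hk hT _ hlt, word_wordValue, (hW _).1, (hW _).2, mul_one]
  exact ⟨rfl, rfl⟩

/-- The labels `h` such that the tuple with `h` at the vertices `ω ⊇ {0, …, d - 1}` and `1`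
elsewhere is realised by a cube. -/
def vertexGroup (d : ℕ) : Subgroup G := (cubeGroup hk hT).comap (face (Finset.range d))

theorem mem_vertexGroup {d : ℕ} {h : G} :
    h ∈ vertexGroup hk hT d ↔ face (Finset.range d) h ∈ cubeGroup hk hT := Iff.rfl

theorem face_empty_mem_cubeGroup (hsync : T.Synchronising) (hsurj : ∀ g, ∃ n, T.labelAt n = g)
    (g : G) : face ∅ g ∈ cubeGroup hk hT := by
  obtain ⟨n, rfl⟩ := hsurj g
  convert labelAt_cubeValue_mem_cubeGroup hk hT hsync n (fun _ => 0) 0 (fun _ _ => rfl) using 1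
  funext ω
  simp [face_apply, cubeValue]

theorem face_singleton_mem_cubeGroup (hsync : T.Synchronising) (hsurj : ∀ g, ∃ n, T.labelAt n = g)
    (i : ℕ) (g : G) : face {i} g ∈ cubeGroup hk hT := by
  obtain ⟨n, rfl⟩ := hsurj g
  convert labelAt_cubeValue_mem_cubeGroup hk hT hsync 0 (Pi.single i n) (i + 1) (fun j hj => by
    rw [Pi.single_eq_of_ne (by omega)]) using 1
  funext ω
  by_cases h : i ∈ ω <;> simp [face_apply, cubeValue, h, T.labelAt_zero]

theorem vertexGroup_normal (hsync : T.Synchronising) (hsurj : ∀ g, ∃ n, T.labelAt n = g) (d : ℕ) :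
    (vertexGroup hk hT d).Normal := by
  refine ⟨fun h hh g => ?_⟩
  have hg := face_empty_mem_cubeGroup hk hT hsync hsurj g
  have := (cubeGroup hk hT).mul_mem ((cubeGroup hk hT).mul_mem hg hh)
    ((cubeGroup hk hT).inv_mem hg)
  rw [mem_vertexGroup]
  convert this using 1
  funext ω
  by_cases hI : Finset.range d ⊆ ω <;> simp [face_apply, hI]

theorem vertexGroup_one (hsync : T.Synchronising) (hsurj : ∀ g, ∃ n, T.labelAt n = g) (g : G) :
    g ∈ vertexGroup hk hT 1 :=
  face_singleton_mem_cubeGroup hk hT hsync hsurj 0 g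

/-- The commutator of an edge direction `d`, carrying `g`, with the face `ω ⊇ {0, …, d - 1}`,
carrying `h`, is concentrated on `ω ⊇ {0, …, d}`. -/
theorem commutator_mem_vertexGroup (hsync : T.Synchronising) (hsurj : ∀ g, ∃ n, T.labelAt n = g)
    {d : ℕ} {h : G} (hh : h ∈ vertexGroup hk hT d) (g : G) :
    ⁅g, h⁆ ∈ vertexGroup hk hT (d + 1) := by
  have hg := face_singleton_mem_cubeGroup hk hT hsync hsurj d g
  rw [mem_vertexGroup, Finset.range_add_one, Finset.insert_eq, ← face_commutator, commutatorElement_def]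
  exact mul_mem (mul_mem (mul_mem hg hh) (inv_mem hg)) (inv_mem hh)

/-- Dividing the cube by its degeneration with `n_j = 0` trivialises the face `ω_j = 0` and puts a
difference on the opposite face. -/
theorem iterDeriv_cube_mem_cubeGroup (hsync : T.Synchronising) (n₀ : ℕ) (n : ℕ → ℕ) (D : ℕ)
    (hD : ∀ i, D ≤ i → n i = 0) (j : ℕ) :
    (fun ω => if Finset.range j ⊆ ω then
      iterDeriv T.labelAt n j (cubeValue n₀ n (ω \ Finset.range j)) else 1) ∈ cubeGroup hk hT := by
  induction j generalizing n with
  | zero => simpa [iterDeriv] using labelAt_cubeValue_mem_cubeGroup hk hT hsync n₀ n D hD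
  | succ j ih =>
    have h1 := ih n hD
    have h2 := ih (Function.update n j 0) fun i hi => by
      by_cases hij : i = j
      · simp [hij]
      · simp [hij, hD i hi]
    have h3 := mul_mem (inv_mem h2) h1
    convert h3 using 1
    funext ω
    have hu : ∀ x, iterDeriv T.labelAt (Function.update n j 0) j x = iterDeriv T.labelAt n j x :=
      iterDeriv_congr _ fun i hi => by simp [Nat.ne_of_lt hi]
    by_cases hr : Finset.range j ⊆ ω
    · by_cases hj : j ∈ ω
      · have hr' : Finset.range (j + 1) ⊆ ω := by
          rw [Finset.range_add_one]
          exact Finset.insert_subset hj hr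
        have hins : ω \ Finset.range j = insert j (ω \ Finset.range (j + 1)) := by
          ext i
          simp only [Finset.mem_sdiff, Finset.mem_range, Finset.mem_insert]
          constructor
          · rintro ⟨h, h'⟩
            by_cases hij : i = j
            · exact Or.inl hij
            · exact Or.inr ⟨h, by omega⟩
          · rintro (rfl | ⟨h, h'⟩)
            · exact ⟨hj, by omega⟩
            · exact ⟨h, by omega⟩
        have hnot : j ∉ ω \ Finset.range (j + 1) := by simp
        have hs : ∑ i ∈ ω \ Finset.range (j + 1), Function.update n j 0 i =
            ∑ i ∈ ω \ Finset.range (j + 1), n i := by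
          refine Finset.sum_congr rfl fun i hi => ?_
          rw [Function.update_of_ne]
          rintro rfl
          exact hnot hi
        simp only [hr, hr', if_true, Pi.mul_apply, Pi.inv_apply, hu, iterDeriv, cubeValue, hins,
          Finset.sum_insert hnot, Function.update_self, zero_add, hs]
        rw [add_assoc, add_comm (n j)]
      · have hr' : ¬ Finset.range (j + 1) ⊆ ω := fun h => hj (h (by simp))
        have hs : cubeValue n₀ (Function.update n j 0) (ω \ Finset.range j) =
            cubeValue n₀ n (ω \ Finset.range j) := by
          refine congrArg (n₀ + ·) (Finset.sum_congr rfl fun i hi => ?_)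
          rw [Function.update_of_ne]
          rintro rfl
          exact hj (Finset.mem_sdiff.mp hi).1
        simp [hr, hr', hu, hs]
    · have hr' : ¬ Finset.range (j + 1) ⊆ ω := fun h =>
        hr ((Finset.range_subset_range.mpr (by omega)).trans h)
      simp [hr, hr']

theorem iterDeriv_mem_vertexGroup (hsync : T.Synchronising) (x d : ℕ) (n : ℕ → ℕ)
    (hn : ∀ i, d ≤ i → n i = 0) : iterDeriv T.labelAt n d x ∈ vertexGroup hk hT d := by
  have := iterDeriv_cube_mem_cubeGroup hk hT hsync x n d hn d
  rw [mem_vertexGroup]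
  convert this using 1
  funext ω
  have : ∑ i ∈ ω \ Finset.range d, n i = 0 :=
    Finset.sum_eq_zero fun i hi => hn i (by simpa using (Finset.mem_sdiff.mp hi).2)
  simp [face_apply, cubeValue, this]

end CubeGroup

section Efficient

variable {k : ℕ} [NeZero k] {S G : Type*} [Group G] {T : GroupExtAutomaton k S G}
  {d' : ℕ} {g₀ : G} {G₀ : Subgroup G}

/-- If the labels are polynomial in an abelian quotient of `G`, they are of the form `n ↦ c ^ n`
there; the order of `c` is coprime to `k`, so it divides `d'`, and `G₀` becomes trivial. -/
theorem IsEfficient.map_eq_one (hk : 2 ≤ k) (hT : IsEfficient T d' g₀ G₀) {A : Type*}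
    [CommGroup A] [Finite A] (π : G →* A) (d : ℕ)
    (hπ : ∀ (n : ℕ → ℕ), (∀ i, d + 2 ≤ i → n i = 0) →
      ∀ x, π (iterDeriv T.labelAt n (d + 2) x) = 1)
    {h : G} (hh : h ∈ G₀) : π h = 1 := by
  have hP := hT.idempotent.1
  set f : ℕ → Additive A := fun n => Additive.ofMul (π (T.labelAt n)) with hf
  obtain ⟨W, hW⟩ := hT.synchronising
  have hsplit : SplitsAt k W.length (wordValue k W) f := by
    intro β x y hy
    have e : x * k ^ (W.length + β) + wordValue k W * k ^ β + y =
        (x * k ^ W.length + wordValue k W) * k ^ β + y := by ring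
    simp only [hf, e]
    rw [GroupExtAutomaton.labelAt_mul_pow_add hk hP _ hy,
      GroupExtAutomaton.stateAt_mul_pow_add hk hP _ (wordValue_lt W),
      GroupExtAutomaton.labelAt_mul_pow_add hk hP _ (wordValue_lt W), word_wordValue, (hW _).1,
      (hW _).2, mul_one, (GroupExtAutomaton.run_init_word_and_labelWord_init_word hk hP hy).2,
      map_mul, ofMul_mul]
  have hlin := eq_nsmul_of_iterDiff_eq_zero hk hsplit
    (fun n => by simp only [hf, GroupExtAutomaton.labelAt_mul_base hk hP hT.label_zero])
    (by simp [hf, T.labelAt_zero]) d (fun l hl x => by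
      have hn := hπ (fun i => l.getD i 0) (fun i hi => List.getD_eq_default l 0 (by omega)) x
      have hl' : (List.range (d + 2)).map (fun i => l.getD i 0) = l := by
        apply List.ext_getElem (by simp [hl])
        intro i h1 h2
        simp [h2]
      rw [← hl', ← ofMul_map_iterDeriv, hn, ofMul_one])
  have hk1 : (k - 1) • f 1 = 0 := by
    have h1 : f (k * 1) = f 1 := by
      simp only [hf, GroupExtAutomaton.labelAt_mul_base hk hP hT.label_zero]
    rw [mul_one, hlin k] at h1
    have h2 : (k - 1 + 1) • f 1 = f 1 := by rwa [Nat.sub_add_cancel (by omega)]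
    rw [succ_nsmul] at h2
    simpa using h2
  have hcop : (addOrderOf (f 1)).Coprime k := by
    have h1 := addOrderOf_dvd_iff_nsmul_eq_zero.mpr hk1
    refine Nat.Coprime.coprime_dvd_left h1 ?_
    have := (Nat.coprime_self_add_right (m := k - 1) (n := 1)).mpr (Nat.coprime_one_right _)
    rwa [Nat.sub_add_cancel (by omega)] at this
  have hdvd : addOrderOf (f 1) ∣ d' := by
    obtain ⟨L, hL⟩ := hT.gcd_eq T.init T.init 1 G₀.one_mem
    obtain ⟨⟨hc, hd⟩, hmax⟩ := hL L le_rfl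
    have hle : Nat.lcm (addOrderOf (f 1)) d' ≤ d' := by
      refine hmax ⟨?_, ?_⟩
      · exact Nat.Coprime.coprime_dvd_left (Nat.lcm_dvd_mul _ _) (Nat.Coprime.mul_left hcop hc)
      · intro a ha
        refine Nat.lcm_dvd ?_ (hd a ha)
        obtain ⟨w, -, -, hw, rfl⟩ := ha
        rw [addOrderOf_dvd_iff_nsmul_eq_zero, ← hlin]
        simp only [hf, GroupExtAutomaton.labelAt_wordValue hk hP, hw, map_one, ofMul_one]
    have hle' := Nat.le_antisymm hle
      (Nat.le_of_dvd (Nat.pos_of_ne_zero (Nat.lcm_ne_zero (addOrderOf_pos _).ne' (hT.pos hk).ne'))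
        (Nat.dvd_lcm_right _ _))
    rw [← hle']
    exact Nat.dvd_lcm_left _ _
  have hmem : h ∈ (fun h => h * g₀ ^ 0) '' (G₀ : Set G) := ⟨h, hh, by simp⟩
  rw [← (hT.labels_mod T.init T.init 0 (hT.pos hk)).1] at hmem
  obtain ⟨w, -, hmod, rfl⟩ := hmem
  have h0 : f (wordValue k w) = 0 := by
    rw [hlin]
    exact addOrderOf_dvd_iff_nsmul_eq_zero.mp (hdvd.trans (Nat.modEq_zero_iff_dvd.mp hmod))
  simpa [hf, GroupExtAutomaton.labelAt_wordValue hk hP] using h0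

variable [Finite G]

/-- The labels in `G₀` occur at the last vertex of cubes of every dimension. -/
theorem IsEfficient.le_vertexGroup (hk : 2 ≤ k) (hT : IsEfficient T d' g₀ G₀) (d : ℕ) :
    G₀ ≤ vertexGroup hk hT.idempotent.1 (d + 1) := by
  have hsurj := hT.exists_labelAt_eq hk
  induction d with
  | zero => exact fun g _ => vertexGroup_one hk _ hT.synchronising hsurj g
  | succ d ih =>
    set N := vertexGroup hk hT.idempotent.1 (d + 1 + 1) with hN
    have : N.Normal := vertexGroup_normal hk _ hT.synchronising hsurj _
    -- `G₀` is central modulo `N`, and `G / G₀` is cyclic, so `G / N` is abelian.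
    have hcent : ∀ h ∈ G₀, ∀ g : G,
        Commute (QuotientGroup.mk' N g) (QuotientGroup.mk' N h) := by
      intro h hh g
      rw [← commutatorElement_eq_one_iff_commute, ← map_commutatorElement]
      exact (QuotientGroup.eq_one_iff _).mpr
        (commutator_mem_vertexGroup hk _ hT.synchronising hsurj (ih hh) g)
    have hcomm : ∀ a b : G ⧸ N, a * b = b * a := by
      intro a b
      obtain ⟨x, rfl⟩ := QuotientGroup.mk'_surjective N a
      obtain ⟨y, rfl⟩ := QuotientGroup.mk'_surjective N b
      obtain ⟨h, hh, r, -, rfl⟩ := hT.exists_eq_mul_pow hk x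
      obtain ⟨h', hh', r', -, rfl⟩ := hT.exists_eq_mul_pow hk y
      have hp : Commute (QuotientGroup.mk' N (g₀ ^ r)) (QuotientGroup.mk' N (g₀ ^ r')) :=
        (Commute.pow_pow_self g₀ r r').map (QuotientGroup.mk' N)
      rw [map_mul (QuotientGroup.mk' N) h]
      refine Commute.mul_left (hcent h hh _).symm ?_
      rw [map_mul]
      exact Commute.mul_right (hcent h' hh' _) hp
    let _ : CommGroup (G ⧸ N) := { QuotientGroup.Quotient.group N with mul_comm := hcomm }
    intro h hh
    have := hT.map_eq_one hk (QuotientGroup.mk' N) d (fun n hn x =>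
      (QuotientGroup.eq_one_iff _).mpr
        (iterDeriv_mem_vertexGroup hk _ hT.synchronising x _ n hn)) hh
    exact (QuotientGroup.eq_one_iff _).mp this

/-- For every `h ∈ G₀` there is a parallelepiped all of whose vertices lead back to the initial
state, the last one with label `h` and the others with label `1`. -/
theorem IsEfficient.exists_cube (hk : 2 ≤ k) (hT : IsEfficient T d' g₀ G₀) {d : ℕ} (hd : 1 ≤ d)
    {h : G} (hh : h ∈ G₀) : ∃ (n₀ : ℕ) (n : Fin d → ℕ), ∀ ω : Finset (Fin d),
      T.stateAt (cubeValue n₀ n ω) = T.init ∧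
      T.labelAt (cubeValue n₀ n ω) = if ω = Finset.univ then h else 1 := by
  obtain ⟨d, rfl⟩ := Nat.exists_eq_add_of_le' hd
  obtain ⟨n₀, n, -, hn⟩ := hT.le_vertexGroup hk d hh
  refine ⟨n₀, fun i => n i, fun ω => ?_⟩
  have hv : cubeValue n₀ (fun i : Fin (d + 1) => n i) ω =
      cubeValue n₀ n (ω.map Fin.valEmbedding) := by
    simp [cubeValue]
  have hω : Finset.range (d + 1) ⊆ ω.map Fin.valEmbedding ↔ ω = Finset.univ := by
    constructor
    · intro hsub
      ext i
      have := hsub (Finset.mem_range.mpr i.2)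
      obtain ⟨a, ha, hai⟩ := Finset.mem_map.mp this
      simpa [← Fin.ext hai] using ha
    · rintro rfl i hi
      simpa using Finset.mem_range.mp hi
  rw [hv, (hn _).1, (hn _).2, face_apply]
  simp only [hω, and_self]

end Efficient

/-! ### Cancellation along blocks of digits -/

/-- The pairs `(n₀, (n₁, …, n_d))` of a base point and a vector of steps with all entries less
than `K`. -/
def box (d K : ℕ) : Finset (ℕ × (Fin d → ℕ)) :=
  Finset.range K ×ˢ Fintype.piFinset fun _ => Finset.range K

theorem mem_box {d K : ℕ} {v : ℕ × (Fin d → ℕ)} : v ∈ box d K ↔ v.1 < K ∧ ∀ i, v.2 i < K := by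
  simp [box]

theorem card_box (d K : ℕ) : (box d K).card = K ^ (d + 1) := by
  simp [box, pow_succ']

theorem sum_box_mul {M : Type*} [AddCommMonoid M] (d K B : ℕ) (F : ℕ × (Fin d → ℕ) → M) :
    ∑ n ∈ box d (K * B), F n =
      ∑ e ∈ box d B, ∑ v ∈ box d K, F (v.1 * B + e.1, fun i => v.2 i * B + e.2 i) := by
  rw [← Finset.sum_product']
  have hlt : ∀ {a b : ℕ}, a < K → b < B → a * B + b < K * B := fun {a b} ha hb => by
    calc a * B + b < (a + 1) * B := by rw [add_mul, one_mul]; omega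
      _ ≤ K * B := Nat.mul_le_mul_right _ ha
  have hdiv : ∀ {a b : ℕ}, b < B → (a * B + b) / B = a := fun {a b} hb => by
    rw [Nat.add_comm, Nat.add_mul_div_right _ _ (by omega), Nat.div_eq_of_lt hb, zero_add]
  have hmod : ∀ {a b : ℕ}, b < B → (a * B + b) % B = b := fun {a b} hb => by
    rw [Nat.add_comm, Nat.add_mul_mod_self_right, Nat.mod_eq_of_lt hb]
  symm
  refine Finset.sum_nbij'
    (fun p => (p.2.1 * B + p.1.1, fun i => p.2.2 i * B + p.1.2 i))
    (fun n => ((n.1 % B, fun i => n.2 i % B), (n.1 / B, fun i => n.2 i / B)))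
    ?_ ?_ ?_ ?_ ?_
  · rintro ⟨e, v⟩ h
    obtain ⟨he, hv⟩ := Finset.mem_product.mp h
    rw [mem_box] at he hv ⊢
    exact ⟨hlt hv.1 he.1, fun i => hlt (hv.2 i) (he.2 i)⟩
  · rintro n hn
    rw [mem_box] at hn
    have hB : 0 < B := Nat.pos_of_ne_zero (by rintro rfl; simp at hn)
    refine Finset.mem_product.mpr ⟨mem_box.mpr ⟨Nat.mod_lt _ hB, fun i => Nat.mod_lt _ hB⟩,
      mem_box.mpr ⟨?_, fun i => ?_⟩⟩
    · exact Nat.div_lt_of_lt_mul (by rw [mul_comm]; exact hn.1)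
    · exact Nat.div_lt_of_lt_mul (by rw [mul_comm]; exact hn.2 i)
  · rintro ⟨e, v⟩ h
    obtain ⟨he, -⟩ := Finset.mem_product.mp h
    rw [mem_box] at he
    simp only [hdiv he.1, hmod he.1, hdiv (he.2 _), hmod (he.2 _)]
  · rintro n -
    simp only [Nat.div_add_mod']
  · rintro p -
    rfl

theorem cubeValue_le_of_mem_box {d K : ℕ} {v : ℕ × (Fin d → ℕ)} (hv : v ∈ box d K)
    (ω : Finset (Fin d)) : cubeValue v.1 v.2 ω + (d + 1) ≤ (d + 1) * K := by
  rw [mem_box] at hv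
  have h1 : ∑ i ∈ ω, v.2 i ≤ d * (K - 1) := by
    calc ∑ i ∈ ω, v.2 i ≤ ω.card • (K - 1) :=
          Finset.sum_le_card_nsmul _ _ _ fun i _ => by have := hv.2 i; omega
      _ ≤ d * (K - 1) := Nat.mul_le_mul_right _ (by simpa using Finset.card_le_univ ω)
  obtain ⟨K, rfl⟩ : ∃ K', K = K' + 1 := ⟨K - 1, by omega⟩
  rw [cubeValue]
  have : v.1 ≤ K := by omega
  rw [Nat.add_sub_cancel] at h1
  nlinarith

section BlockSum

variable {k : ℕ} [NeZero k] {S G : Type*} [Group G] {d : ℕ}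

/-- The sum of a test function `Φ` over all `v ∈ [k ^ L]^{d+1}`. At the vertex `ω` the integer
`v₀ + ∑_{i ∈ ω} vᵢ + r_ω` splits into its `L` lowest digits and the remaining part `c_ω`; the
function `Φ` is evaluated at the tuple of the `c_ω`, and at the tuples of states and labels obtained
by reading the `L` digits from the states `σ c ω`. -/
noncomputable def blockSum (T : GroupExtAutomaton k S G) (L : ℕ)
    (Φ : (Finset (Fin d) → ℕ) → (Finset (Fin d) → S) → (Finset (Fin d) → G) → ℂ)
    (σ : (Finset (Fin d) → ℕ) → Finset (Fin d) → S) (r : Finset (Fin d) → ℕ) : ℂ :=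
  ∑ v ∈ box d (k ^ L),
    Φ (fun ω => (cubeValue v.1 v.2 ω + r ω) / k ^ L)
      (fun ω => T.run (σ (fun ω => (cubeValue v.1 v.2 ω + r ω) / k ^ L) ω)
        (word k L (cubeValue v.1 v.2 ω + r ω)))
      (fun ω => T.labelWord (σ (fun ω => (cubeValue v.1 v.2 ω + r ω) / k ^ L) ω)
        (word k L (cubeValue v.1 v.2 ω + r ω)))

/-- The test function obtained from `Φ` by first reading the `l` lowest digits of `y_ω`. -/
def pullback (T : GroupExtAutomaton k S G) (l : ℕ) (y : Finset (Fin d) → ℕ)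
    (Φ : (Finset (Fin d) → ℕ) → (Finset (Fin d) → S) → (Finset (Fin d) → G) → ℂ) :
    (Finset (Fin d) → ℕ) → (Finset (Fin d) → S) → (Finset (Fin d) → G) → ℂ :=
  fun c t g => Φ c (fun ω => T.run (t ω) (word k l (y ω)))
    (g * fun ω => T.labelWord (t ω) (word k l (y ω)))

/-- Splitting off the lowest block of digits. -/
theorem blockSum_add (T : GroupExtAutomaton k S G) (L l : ℕ)
    (Φ : (Finset (Fin d) → ℕ) → (Finset (Fin d) → S) → (Finset (Fin d) → G) → ℂ)
    (σ : (Finset (Fin d) → ℕ) → Finset (Fin d) → S) (r : Finset (Fin d) → ℕ) :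
    blockSum T (L + l) Φ σ r = ∑ e ∈ box d (k ^ l),
      blockSum T L (pullback T l (fun ω => cubeValue e.1 e.2 ω + r ω) Φ) σ
        (fun ω => (cubeValue e.1 e.2 ω + r ω) / k ^ l) := by
  have hpos : 0 < k ^ l := Nat.pow_pos (Nat.pos_of_ne_zero (NeZero.ne k))
  rw [blockSum, pow_add, sum_box_mul]
  refine Finset.sum_congr rfl fun e _ => Finset.sum_congr rfl fun v _ => ?_
  have hd : ∀ ω, (cubeValue (v.1 * k ^ l + e.1) (fun i => v.2 i * k ^ l + e.2 i) ω + r ω) / k ^ l =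
      cubeValue v.1 v.2 ω + (cubeValue e.1 e.2 ω + r ω) / k ^ l := by
    intro ω
    rw [cubeValue_mul_add, add_assoc, Nat.add_comm, Nat.add_mul_div_right _ _ hpos, Nat.add_comm]
  have hw : ∀ ω, word k l (cubeValue (v.1 * k ^ l + e.1) (fun i => v.2 i * k ^ l + e.2 i) ω + r ω) =
      word k l (cubeValue e.1 e.2 ω + r ω) := by
    intro ω
    rw [cubeValue_mul_add, add_assoc, word_mul_pow_add]
  simp only [pullback, mul_comm (k ^ L) (k ^ l), ← Nat.div_div_eq_div_mul, hd, word_add, hw,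
    Automaton.run_append, GroupExtAutomaton.labelWord_append]
  rfl

variable {T : GroupExtAutomaton k S G} {d' : ℕ} {g₀ : G} {G₀ : Subgroup G}

/-- The test function `Φ` has mean zero along the cosets of `G₀` placed at the last vertex. -/
def Cancels (G₀ : Subgroup G) [Fintype G₀]
    (Φ : (Finset (Fin d) → ℕ) → (Finset (Fin d) → S) → (Finset (Fin d) → G) → ℂ) : Prop :=
  ∀ c t g, ∑ h : G₀, Φ c t (g * Pi.mulSingle (M := fun _ => G) Finset.univ (h : G)) = 0

theorem Cancels.sum_mul_eq_zero [Fintype G₀] (hG : G₀.Normal)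
    {Φ : (Finset (Fin d) → ℕ) → (Finset (Fin d) → S) → (Finset (Fin d) → G) → ℂ}
    (hΦ : Cancels G₀ Φ) (c : Finset (Fin d) → ℕ) (t : Finset (Fin d) → S)
    (g g' : Finset (Fin d) → G) :
    ∑ h : G₀, Φ c t (g * Pi.mulSingle (M := fun _ => G) Finset.univ (h : G) * g') = 0 := by
  have := hG
  rw [← hΦ c t (g * g')]
  refine Fintype.sum_equiv (MulAut.conjNormal (g' Finset.univ)⁻¹).toEquiv _ _ fun h => ?_
  congr 1
  funext ω
  by_cases hω : ω = Finset.univ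
  · subst hω
    simp [mul_assoc]
  · simp [hω]

theorem Cancels.pullback [Fintype G₀] (hG : G₀.Normal)
    {Φ : (Finset (Fin d) → ℕ) → (Finset (Fin d) → S) → (Finset (Fin d) → G) → ℂ}
    (hΦ : Cancels G₀ Φ) (T : GroupExtAutomaton k S G) (l : ℕ) (y : Finset (Fin d) → ℕ) :
    Cancels G₀ (pullback T l y Φ) :=
  fun c _ g => hΦ.sum_mul_eq_zero hG c _ g _

/-- Special blocks: for each `h ∈ G₀` a vector of blocks consisting of a synchronising word, a cube
with label `h` at the last vertex and `1` elsewhere, and zeros absorbing the incoming carry. Reading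
it erases the state and produces no carry. -/
theorem IsEfficient.exists_special_blocks [Finite G] (hk : 2 ≤ k) (hT : IsEfficient T d' g₀ G₀)
    (hd : 1 ≤ d) : ∃ (l m : ℕ) (X : G₀ → ℕ × (Fin d → ℕ)), 1 ≤ l ∧
      ∀ (h : G₀), X h ∈ box d (k ^ l) ∧ ∀ (ω : Finset (Fin d)) (r : ℕ), r ≤ d →
        cubeValue (X h).1 (X h).2 ω + r < k ^ l ∧ ∀ t : S,
          T.run t (word k l (cubeValue (X h).1 (X h).2 ω + r)) = T.run T.init (word k m r) ∧
          T.labelWord t (word k l (cubeValue (X h).1 (X h).2 ω + r)) =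
            Pi.mulSingle (M := fun _ => G) Finset.univ (h : G) ω *
              T.labelWord T.init (word k m r) := by
  have hP := hT.idempotent.1
  have hk0 : 0 < k := by omega
  choose n₀ n hn using fun h : G₀ => hT.exists_cube hk hd h.2
  obtain ⟨W, hW⟩ := hT.synchronising
  obtain ⟨b, hb⟩ : ∃ b, ∀ h, n₀ h + ∑ i, n h i < b := by
    obtain ⟨b, hb⟩ := (Set.finite_range fun h => n₀ h + ∑ i, n h i).bddAbove
    exact ⟨b + 1, fun h => Nat.lt_succ_of_le (hb ⟨h, rfl⟩)⟩
  have hb' : b < k ^ b := Nat.lt_pow_self hk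
  have hd' : d < k ^ d := Nat.lt_pow_self hk
  have hval : ∀ h ω, cubeValue (n₀ h) (n h) ω < k ^ b := by
    intro h ω
    have : cubeValue (n₀ h) (n h) ω ≤ n₀ h + ∑ i, n h i :=
      Nat.add_le_add_left (Finset.sum_le_univ_sum_of_nonneg fun _ => Nat.zero_le _) _
    have := hb h
    omega
  let X : G₀ → ℕ × (Fin d → ℕ) := fun h =>
    ((wordValue k W * k ^ b + n₀ h) * k ^ d + 0, fun i => n h i * k ^ d + 0)
  have hX : ∀ h ω, cubeValue (X h).1 (X h).2 ω =
      (wordValue k W * k ^ b + cubeValue (n₀ h) (n h) ω) * k ^ d := by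
    intro h ω
    have e := cubeValue_mul_add (wordValue k W * k ^ b + n₀ h) 0 (k ^ d) (n h) (fun _ => 0) ω
    have e' : cubeValue 0 (fun _ => 0) ω = 0 := by simp [cubeValue]
    rw [e'] at e
    refine e.trans ?_
    simp [cubeValue, add_assoc]
  have hlt : ∀ h ω r, r ≤ d → cubeValue (X h).1 (X h).2 ω + r < k ^ (W.length + b + d) := by
    intro h ω r hr
    have h1 := wordValue_lt W
    have h2 := hval h ω
    rw [hX, pow_add, pow_add]
    calc (wordValue k W * k ^ b + cubeValue (n₀ h) (n h) ω) * k ^ d + r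
        < (wordValue k W * k ^ b + cubeValue (n₀ h) (n h) ω + 1) * k ^ d := by
          rw [add_mul _ 1, one_mul]; omega
      _ ≤ ((wordValue k W + 1) * k ^ b) * k ^ d := by
          apply Nat.mul_le_mul_right
          rw [add_mul, one_mul]; omega
      _ ≤ k ^ W.length * k ^ b * k ^ d :=
          Nat.mul_le_mul_right _ (Nat.mul_le_mul_right _ h1)
  refine ⟨W.length + b + d, d, X, by omega, fun h => ⟨mem_box.mpr ⟨?_, fun i => ?_⟩, ?_⟩⟩
  · simpa [cubeValue] using hlt h ∅ 0 (Nat.zero_le _)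
  · have := hlt h {i} 0 (Nat.zero_le _)
    simp only [cubeValue, Finset.sum_singleton] at this
    omega
  · intro ω r hr
    refine ⟨hlt h ω r hr, fun t => ?_⟩
    have hrd : r < k ^ d := by omega
    have hw : word k (W.length + b + d) (cubeValue (X h).1 (X h).2 ω + r) =
        W ++ word k b (cubeValue (n₀ h) (n h) ω) ++ word k d r := by
      rw [hX, word_add, word_mul_pow_add, Nat.add_comm (_ * k ^ d), Nat.add_mul_div_right _ _
        (Nat.pow_pos hk0), Nat.div_eq_of_lt hrd, zero_add, word_add, word_mul_pow_add,
        Nat.add_comm (_ * k ^ b), Nat.add_mul_div_right _ _ (Nat.pow_pos hk0),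
        Nat.div_eq_of_lt (hval h ω), zero_add, word_wordValue]
    obtain ⟨h1, h2⟩ :=
      GroupExtAutomaton.run_init_word_and_labelWord_init_word hk hP (hval h ω)
    rw [hw]
    simp only [Automaton.run_append, GroupExtAutomaton.labelWord_append, (hW t).1, (hW t).2, h1, h2,
      (hn h ω).1, (hn h ω).2, one_mul, Pi.mulSingle_apply, true_and]

/-- Power saving for the sums of test functions with cancellation: every block of `l` digits
contributes a factor at most the number of blocks minus one, because the special blocks cancel. -/
theorem IsEfficient.exists_norm_blockSum_le [Finite G] [Fintype G₀] (hk : 2 ≤ k)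
    (hT : IsEfficient T d' g₀ G₀) (hd : 1 ≤ d) : ∃ l, 1 ≤ l ∧ ∀ (j : ℕ)
      (Φ : (Finset (Fin d) → ℕ) → (Finset (Fin d) → S) → (Finset (Fin d) → G) → ℂ) (C : ℝ),
      Cancels G₀ Φ → (∀ c t g, ‖Φ c t g‖ ≤ C) →
      ∀ (σ : (Finset (Fin d) → ℕ) → Finset (Fin d) → S) (r : Finset (Fin d) → ℕ),
        (∀ ω, r ω ≤ d) →
        ‖blockSum T (l * j) Φ σ r‖ ≤ (((k ^ l) ^ (d + 1) - 1 : ℕ) : ℝ) ^ j * C := by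
  classical
  obtain ⟨l, m, X, hl, hX⟩ := hT.exists_special_blocks hk hd
  refine ⟨l, hl, fun j => ?_⟩
  induction j with
  | zero =>
    intro Φ C _ hC σ r _
    simpa [blockSum, card_box, box] using hC _ _ _
  | succ j ih =>
    intro Φ C hΦ hC σ r hr
    have hinj : Function.Injective X := by
      intro h h' e
      have h1 := (((hX h).2 Finset.univ 0 (Nat.zero_le _)).2 T.init).2
      rw [e, (((hX h').2 Finset.univ 0 (Nat.zero_le _)).2 T.init).2] at h1
      simpa [eq_comm] using h1
    have hsub : Finset.univ.image X ⊆ box d (k ^ l) := by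
      intro e he
      obtain ⟨h, -, rfl⟩ := Finset.mem_image.mp he
      exact (hX h).1
    have hnonempty : (Finset.univ.image X).Nonempty := Finset.univ_nonempty.image X
    rw [Nat.mul_succ, blockSum_add, ← Finset.sum_sdiff hsub,
      Finset.sum_image fun h _ h' _ e => hinj e]
    -- The special blocks differ only in the factor `h` at the last vertex.
    have hzero : ∑ h : G₀, blockSum T (l * j)
        (pullback T l (fun ω => cubeValue (X h).1 (X h).2 ω + r ω) Φ) σ
        (fun ω => (cubeValue (X h).1 (X h).2 ω + r ω) / k ^ l) = 0 := by
      have hc : ∀ h ω, (cubeValue (X h).1 (X h).2 ω + r ω) / k ^ l = 0 := fun h ω =>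
        Nat.div_eq_of_lt ((hX h).2 ω (r ω) (hr ω)).1
      simp only [hc]
      simp only [blockSum, pullback]
      rw [Finset.sum_comm]
      refine Finset.sum_eq_zero fun v _ => ?_
      have hs : ∀ h ω t, T.run t (word k l (cubeValue (X h).1 (X h).2 ω + r ω)) =
          T.run T.init (word k m (r ω)) := fun h ω t =>
        (((hX h).2 ω (r ω) (hr ω)).2 t).1
      have hlab : ∀ h ω t, T.labelWord t (word k l (cubeValue (X h).1 (X h).2 ω + r ω)) =
          Pi.mulSingle (M := fun _ => G) Finset.univ (h : G) ω *
            T.labelWord T.init (word k m (r ω)) := fun h ω t =>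
        (((hX h).2 ω (r ω) (hr ω)).2 t).2
      simp only [hs, hlab]
      have := hΦ.sum_mul_eq_zero (hT.normal hk)
        (fun ω => (cubeValue v.1 v.2 ω + 0) / k ^ (l * j))
        (fun ω => T.run T.init (word k m (r ω)))
        (fun ω => T.labelWord (σ (fun ω => (cubeValue v.1 v.2 ω + 0) / k ^ (l * j)) ω)
          (word k (l * j) (cubeValue v.1 v.2 ω + 0)))
        (fun ω => T.labelWord T.init (word k m (r ω)))
      rw [← this]
      refine Finset.sum_congr rfl fun h _ => ?_
      rw [mul_assoc]
      rfl
    rw [hzero, add_zero]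
    have hcarry : ∀ e ∈ box d (k ^ l), ∀ ω, (cubeValue e.1 e.2 ω + r ω) / k ^ l ≤ d := by
      intro e he ω
      have h1 := cubeValue_le_of_mem_box he ω
      have h2 := hr ω
      exact Nat.lt_succ_iff.mp (Nat.div_lt_of_lt_mul (by rw [mul_comm, Nat.succ_eq_add_one]; omega))
    calc ‖∑ e ∈ box d (k ^ l) \ Finset.univ.image X, blockSum T (l * j)
          (pullback T l (fun ω => cubeValue e.1 e.2 ω + r ω) Φ) σ
          (fun ω => (cubeValue e.1 e.2 ω + r ω) / k ^ l)‖
        ≤ ∑ e ∈ box d (k ^ l) \ Finset.univ.image X,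
          (((k ^ l) ^ (d + 1) - 1 : ℕ) : ℝ) ^ j * C :=
          norm_sum_le_of_le _ fun e he => ih _ C (hΦ.pullback (hT.normal hk) T l _)
            (fun c t g => hC _ _ _) σ _ (hcarry e (Finset.mem_sdiff.mp he).1)
      _ = ((box d (k ^ l) \ Finset.univ.image X).card : ℝ) *
          ((((k ^ l) ^ (d + 1) - 1 : ℕ) : ℝ) ^ j * C) := by
          rw [Finset.sum_const, nsmul_eq_mul]
      _ ≤ (((k ^ l) ^ (d + 1) - 1 : ℕ) : ℝ) * ((((k ^ l) ^ (d + 1) - 1 : ℕ) : ℝ) ^ j * C) := by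
          have hC0 : 0 ≤ C := (norm_nonneg _).trans (hC (fun _ => 0) (fun _ => T.init) 1)
          refine mul_le_mul_of_nonneg_right (Nat.cast_le.mpr ?_) (by positivity)
          rw [Finset.card_sdiff_of_subset hsub, card_box]
          have := hnonempty.card_pos
          omega
      _ = _ := by ring

end BlockSum

/-! ### Gowers norms on intervals as sums over integer parallelepipeds -/

theorem iterate_star_eq_zero_iff (m : ℕ) (z : ℂ) : (starRingEnd ℂ)^[m] z = 0 ↔ z = 0 := by
  induction m with
  | zero => rfl
  | succ m ih => rw [Function.iterate_succ_apply', map_eq_zero, ih]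

theorem norm_iterate_star (m : ℕ) (z : ℂ) : ‖(starRingEnd ℂ)^[m] z‖ = ‖z‖ := by
  induction m with
  | zero => rfl
  | succ m ih => rw [Function.iterate_succ_apply', RCLike.norm_conj, ih]

theorem iterate_star_ite (m : ℕ) (p : Prop) [Decidable p] :
    (starRingEnd ℂ)^[m] (if p then 1 else 0) = if p then 1 else 0 := by
  induction m with
  | zero => rfl
  | succ m ih => rw [Function.iterate_succ_apply', ih]; split_ifs <;> simp

/-- The value of `1_{[N]} f` at `x - |ω| A`, and `0` if this is negative. -/
noncomputable def shifted {d : ℕ} (N A : ℕ) (f : ℕ → ℂ) (ω : Finset (Fin d)) (x : ℕ) : ℂ :=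
  if ω.card * A ≤ x ∧ x - ω.card * A < N then f (x - ω.card * A) else 0

/-- The sum of `∏_ω 𝒞^{|ω|} (1_{[N]} f)(m₀ + ∑_{i ∈ ω} mᵢ)` over all integers `0 ≤ m₀ < 2A` and
`-A ≤ mᵢ < A`. The steps are stored as the natural numbers `mᵢ + A`. -/
noncomputable def cubeSum (d N A : ℕ) (f : ℕ → ℂ) : ℂ :=
  ∑ n ∈ box d (2 * A), ∏ ω : Finset (Fin d),
    (starRingEnd ℂ)^[ω.card] (shifted N A f ω (cubeValue n.1 n.2 ω))

theorem cutoff_intCast {N P : ℕ} [NeZero P] (f : ℕ → ℂ) {z : ℤ} (h1 : (N : ℤ) - P ≤ z)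
    (h2 : z < P) : cutoff N P f (z : ZMod P) = if 0 ≤ z ∧ z < N then f z.toNat else 0 := by
  rw [cutoff]
  by_cases hz : 0 ≤ z ∧ z < N
  · obtain ⟨m, rfl⟩ := Int.eq_ofNat_of_zero_le hz.1
    have hv : ((m : ℤ) : ZMod P).val = m := by
      rw [Int.cast_natCast, ZMod.val_natCast_of_lt (by exact_mod_cast h2)]
    rw [hv, if_pos hz, if_pos (by exact_mod_cast hz.2), Int.toNat_natCast]
  · rw [if_neg hz, if_neg]
    intro hlt
    set y := (z : ZMod P).val with hy
    have hyz : ((y : ℤ) : ZMod P) = (z : ZMod P) := by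
      rw [Int.cast_natCast, hy, ZMod.natCast_zmod_val]
    have hdvd := (ZMod.intCast_eq_intCast_iff_dvd_sub _ _ _).mp hyz
    have hyP : y < P := ZMod.val_lt _
    have h0 : z - y = 0 := Int.eq_zero_of_abs_lt_dvd hdvd (by rw [abs_lt]; constructor <;> omega)
    exact hz (by omega)

/-- Close to the cube the cutoff function on `ℤ / P` and the one on `ℤ` agree, as `P > 2 d N`. -/
theorem cutoff_cubeValue {d N A P : ℕ} [NeZero P] (hd : 1 ≤ d) (hP : 2 * d * N < P) (f : ℕ → ℂ)
    {n₀ : ℕ} {n : Fin d → ℕ} (h0 : n₀ < N) (h1 : ∀ i, A ≤ n₀ + n i)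
    (h2 : ∀ i, n₀ + n i < A + N) (ω : Finset (Fin d)) :
    cutoff N P f ((n₀ : ZMod P) + ∑ i ∈ ω, ((n i : ZMod P) - A)) =
      shifted N A f ω (cubeValue n₀ n ω) := by
  set z : ℤ := n₀ + ∑ i ∈ ω, ((n i : ℤ) - A) with hz
  have hcast : (n₀ : ZMod P) + ∑ i ∈ ω, ((n i : ZMod P) - A) = (z : ZMod P) := by
    rw [hz]; push_cast; rfl
  have hz' : z = (cubeValue n₀ n ω : ℤ) - (ω.card * A : ℕ) := by
    rw [hz, cubeValue]
    push_cast
    rw [Finset.sum_sub_distrib, Finset.sum_const, nsmul_eq_mul]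
    ring
  have hcard : ω.card ≤ d := by simpa using Finset.card_le_univ ω
  have hub : ∑ i ∈ ω, ((n i : ℤ) - A) ≤ d * N := by
    calc ∑ i ∈ ω, ((n i : ℤ) - A) ≤ ω.card • (N : ℤ) :=
          Finset.sum_le_card_nsmul _ _ _ fun i _ => by have := h2 i; omega
      _ = ω.card * (N : ℤ) := nsmul_eq_mul _ _
      _ ≤ d * N := by gcongr
  have hlb : -(d * N : ℤ) ≤ ∑ i ∈ ω, ((n i : ℤ) - A) := by
    calc -(d * N : ℤ) ≤ -(ω.card * (N : ℤ)) := by gcongr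
      _ = ω.card • (-(N : ℤ)) := by rw [nsmul_eq_mul]; ring
      _ ≤ _ := Finset.card_nsmul_le_sum _ _ _ fun i _ => by have := h1 i; omega
  have hNd : (N : ℤ) ≤ d * N := le_mul_of_one_le_left (by omega) (by exact_mod_cast hd)
  have hP' : 2 * ((d : ℤ) * N) < P := by rw [← mul_assoc]; exact_mod_cast hP
  rw [hcast, cutoff_intCast f (by omega) (by omega), shifted]
  by_cases hc : ω.card * A ≤ cubeValue n₀ n ω ∧ cubeValue n₀ n ω - ω.card * A < N
  · rw [if_pos hc, if_pos (by omega)]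
    congr 1
    omega
  · rw [if_neg hc, if_neg (by omega)]

/-- Summands with a nonzero contribution have all vertices in `[N]`; as `P > 2 d N`, they lift
uniquely to integer parallelepipeds. -/
theorem gowersAverage_cutoff {d N A P : ℕ} [NeZero P] (hd : 1 ≤ d) (hP : 2 * d * N < P)
    (hA : N ≤ A) (f : ℕ → ℂ) :
    gowersAverage d (cutoff N P f) = cubeSum d N A f / (P : ℂ) ^ (d + 1) := by
  rw [gowersAverage, ZMod.card, cubeSum]
  congr 1
  rw [← Fintype.sum_prod_type']
  symm
  have hcond : ∀ n : ℕ × (Fin d → ℕ), (∏ ω : Finset (Fin d),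
      (starRingEnd ℂ)^[ω.card] (shifted N A f ω (cubeValue n.1 n.2 ω))) ≠ 0 →
      n.1 < N ∧ ∀ i, A ≤ n.1 + n.2 i ∧ n.1 + n.2 i < A + N := by
    intro n hn
    rw [Finset.prod_ne_zero_iff] at hn
    have hn' : ∀ ω : Finset (Fin d), ω.card * A ≤ cubeValue n.1 n.2 ω ∧
        cubeValue n.1 n.2 ω - ω.card * A < N := by
      intro ω
      have h := hn ω (Finset.mem_univ _)
      rw [Ne, iterate_star_eq_zero_iff, shifted] at h
      by_contra hc
      exact h (if_neg hc)
    refine ⟨by simpa [cubeValue] using (hn' ∅).2, fun i => ?_⟩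
    have := hn' {i}
    simp only [cubeValue, Finset.sum_singleton, Finset.card_singleton, one_mul] at this
    omega
  have hNP : 2 * N < P := by nlinarith
  have heq : ∀ n : ℕ × (Fin d → ℕ), n.1 < N → (∀ i, A ≤ n.1 + n.2 i ∧ n.1 + n.2 i < A + N) →
      (∏ ω : Finset (Fin d),
        (starRingEnd ℂ)^[ω.card] (shifted N A f ω (cubeValue n.1 n.2 ω))) =
      ∏ ω : Finset (Fin d), (starRingEnd ℂ)^[ω.card]
        (cutoff N P f ((n.1 : ZMod P) + ∑ i ∈ ω, ((n.2 i : ZMod P) - A))) := by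
    intro n h0 h1
    refine Finset.prod_congr rfl fun ω _ => ?_
    rw [cutoff_cubeValue hd hP f h0 (fun i => (h1 i).1) (fun i => (h1 i).2)]
  refine Finset.sum_bij_ne_zero
    (fun n _ _ => ((n.1 : ZMod P), fun i => (n.2 i : ZMod P) - A))
    (fun _ _ _ => Finset.mem_univ _) ?_ ?_ ?_
  · rintro n - hn m - hm e
    obtain ⟨hn0, hn1⟩ := hcond n hn
    obtain ⟨hm0, hm1⟩ := hcond m hm
    rw [Prod.mk.injEq] at e
    have e0 : n.1 = m.1 := by
      rw [← ZMod.val_natCast_of_lt (show n.1 < P by omega), e.1,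
        ZMod.val_natCast_of_lt (show m.1 < P by omega)]
    refine Prod.ext e0 (funext fun i => ?_)
    have e2 : ((n.2 i : ℤ) : ZMod P) = ((m.2 i : ℤ) : ZMod P) := by
      have := congrFun e.2 i
      simpa using this
    have hdvd := (ZMod.intCast_eq_intCast_iff_dvd_sub _ _ _).mp e2
    have h1 := hn1 i
    have h2 := hm1 i
    have h0 : (m.2 i : ℤ) - n.2 i = 0 :=
      Int.eq_zero_of_abs_lt_dvd hdvd (by rw [abs_lt]; constructor <;> omega)
    omega
  · rintro ⟨x₀, x⟩ - hx
    rw [Finset.prod_ne_zero_iff] at hx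
    have hval : ∀ ω : Finset (Fin d), (x₀ + ∑ i ∈ ω, x i).val < N := by
      intro ω
      have h := hx ω (Finset.mem_univ _)
      rw [Ne, iterate_star_eq_zero_iff, cutoff] at h
      by_contra hc
      exact h (if_neg hc)
    have h0 : x₀.val < N := by simpa using hval ∅
    have h1 : ∀ i, (x₀ + x i).val < N := fun i => by simpa using hval {i}
    let n : ℕ × (Fin d → ℕ) := (x₀.val, fun i => A + (x₀ + x i).val - x₀.val)
    have hn1 : ∀ i, A ≤ n.1 + n.2 i ∧ n.1 + n.2 i < A + N := by
      intro i
      have := h1 i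
      simp only [n]
      omega
    have hb : n ∈ box d (2 * A) := by
      refine mem_box.mpr ⟨?_, fun i => ?_⟩
      · simp only [n]; omega
      · have := h1 i
        simp only [n]; omega
    have himg : ((n.1 : ZMod P), fun i => (n.2 i : ZMod P) - A) = (x₀, x) := by
      refine Prod.ext ?_ (funext fun i => ?_)
      · simp only [n, ZMod.natCast_zmod_val]
      · have := h1 i
        simp only [n]
        rw [Nat.cast_sub (by omega), Nat.cast_add, ZMod.natCast_zmod_val, ZMod.natCast_zmod_val]
        ring
    refine ⟨n, hb, ?_, himg⟩
    rw [heq n h0 hn1, Finset.prod_ne_zero_iff]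
    intro ω hω
    have := hx ω hω
    rw [Prod.mk.injEq] at himg
    have e2 : ∀ i, (n.2 i : ZMod P) - A = x i := congrFun himg.2
    simpa only [himg.1, e2] using this
  · rintro n - hn
    obtain ⟨h0, h1⟩ := hcond n hn
    exact heq n h0 h1

/-- There are at least `(N / (d + 1))^{d + 1}` parallelepipeds inside `[N]`. -/
theorem le_norm_cubeSum_one {d N A : ℕ} (hN : 1 ≤ N) (hA : N ≤ A) :
    ((N : ℝ) / (d + 1)) ^ (d + 1) ≤ ‖cubeSum d N A fun _ => 1‖ := by
  classical
  set R := (N + d) / (d + 1) with hR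
  have hR1 : N ≤ (d + 1) * R := by
    have := Nat.div_add_mod (N + d) (d + 1)
    have := Nat.mod_lt (N + d) (Nat.succ_pos d)
    rw [Nat.succ_eq_add_one] at this
    rw [hR]
    omega
  have hR2 : (d + 1) * R ≤ N + d := Nat.mul_div_le _ _
  have hsum : cubeSum d N A (fun _ => 1) = (({n ∈ box d (2 * A) | ∀ ω : Finset (Fin d),
      ω.card * A ≤ cubeValue n.1 n.2 ω ∧ cubeValue n.1 n.2 ω - ω.card * A < N}.card : ℕ) : ℂ) := by
    rw [cubeSum, Finset.card_filter, Nat.cast_sum]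
    refine Finset.sum_congr rfl fun n _ => ?_
    simp only [shifted, iterate_star_ite]
    rw [Finset.prod_ite_zero]
    simp
  rw [hsum, Complex.norm_natCast]
  have hcard : R ^ (d + 1) ≤ {n ∈ box d (2 * A) | ∀ ω : Finset (Fin d),
      ω.card * A ≤ cubeValue n.1 n.2 ω ∧ cubeValue n.1 n.2 ω - ω.card * A < N}.card := by
    rw [← card_box]
    refine Finset.card_le_card_of_injOn (fun v => (v.1, fun i => v.2 i + A)) ?_ ?_
    · intro v hv
      rw [Finset.mem_coe] at hv
      have hle := cubeValue_le_of_mem_box hv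
      have hRA : R ≤ A := by nlinarith
      rw [mem_box] at hv
      refine Finset.mem_coe.mpr (Finset.mem_filter.mpr ⟨mem_box.mpr ⟨?_, fun i => ?_⟩, fun ω => ?_⟩)
      · have := hv.1; simp only; omega
      · have := hv.2 i; simp only; omega
      · have e : cubeValue v.1 (fun i => v.2 i + A) ω = cubeValue v.1 v.2 ω + ω.card * A := by
          simp [cubeValue, Finset.sum_add_distrib, add_assoc]
        have := hle ω
        simp only [e]
        omega
    · intro v _ v' _ e
      simp only [Prod.mk.injEq] at e
      refine Prod.ext e.1 (funext fun i => ?_)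
      have := congrFun e.2 i
      simpa using this
  calc ((N : ℝ) / (d + 1)) ^ (d + 1) ≤ (R : ℝ) ^ (d + 1) := by
        refine pow_le_pow_left₀ (by positivity) ?_ _
        rw [div_le_iff₀ (by positivity)]
        calc (N : ℝ) ≤ (((d + 1) * R : ℕ) : ℝ) := Nat.cast_le.mpr hR1
          _ = R * (d + 1) := by push_cast; ring
    _ ≤ _ := by exact_mod_cast hcard

theorem gowersModulus_spec (d N : ℕ) :
    (gowersModulus d N).Prime ∧ 2 * d * N < gowersModulus d N := by
  classical
  exact Nat.find_spec (p := fun p => p.Prime ∧ 2 * d * N < p) _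

theorem gowersNormInterval_eq {d N A : ℕ} (hd : 1 ≤ d) (hA : N ≤ A) (f : ℕ → ℂ) :
    gowersNormInterval d N f =
      (‖cubeSum d N A f‖ / ‖cubeSum d N A fun _ => 1‖) ^ ((1 : ℝ) / 2 ^ d) := by
  have hP := (gowersModulus_spec d N).2
  rw [gowersNormInterval, gowersNorm, gowersNorm, gowersAverage_cutoff hd hP hA,
    gowersAverage_cutoff hd hP hA, ← Real.div_rpow (norm_nonneg _) (norm_nonneg _), norm_div,
    norm_div, div_div_div_cancel_right₀]
  rw [norm_ne_zero_iff]
  exact pow_ne_zero _ (Nat.cast_ne_zero.mpr (NeZero.ne _))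

/-! ### Gowers uniformity of basic sequences -/

/-- The vectors fixed by a normal subgroup form a subrepresentation; if it vanishes, so does the
sum of `ρ` over the subgroup. -/
theorem sum_representation_eq_zero {G V : Type*} [Group G] [AddCommGroup V] [Module ℂ V]
    (ρ : Representation ℂ G V) (hirr : ρ.IsIrreducible) (G₀ : Subgroup G) [Fintype G₀]
    (hG : G₀.Normal) (hker : ¬ G₀ ≤ MonoidHom.ker ρ) : ∑ h : G₀, ρ (h : G) = 0 := by
  let F : Subrepresentation ρ :=
    { toSubmodule :=
        { carrier := {v | ∀ h ∈ G₀, ρ h v = v}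
          add_mem' := fun {v w} hv hw h hh => by rw [map_add, hv h hh, hw h hh]
          zero_mem' := fun h _ => map_zero _
          smul_mem' := fun c v hv h hh => by rw [map_smul, hv h hh] }
      apply_mem_toSubmodule := fun g v hv h hh => by
        have h1 := hv (g⁻¹ * h * g) (by simpa using hG.conj_mem h hh g⁻¹)
        have h2 : h * g = g * (g⁻¹ * h * g) := by group
        rw [← Module.End.mul_apply, ← map_mul, h2, map_mul, Module.End.mul_apply, h1] }
  have hF : ∀ v, v ∈ F ↔ ∀ h ∈ G₀, ρ h v = v := fun v => Iff.rfl
  rcases hirr.eq_bot_or_eq_top F with h | h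
  · refine LinearMap.ext fun v => ?_
    have hv : (∑ h : G₀, ρ (h : G)) v ∈ F := by
      intro h hh
      rw [LinearMap.sum_apply, map_sum]
      refine Fintype.sum_equiv (Equiv.mulLeft ⟨h, hh⟩) _ _ fun h' => ?_
      simp
    rw [h] at hv
    exact hv
  · refine absurd (fun h₀ hh => ?_) hker
    refine LinearMap.ext fun v => ?_
    have hv : v ∈ F := by rw [h]; exact Submodule.mem_top
    exact hv h₀ hh

theorem iterate_star_sum {ι : Type*} (t : Finset ι) (m : ℕ) (F : ι → ℂ) :
    (starRingEnd ℂ)^[m] (∑ i ∈ t, F i) = ∑ i ∈ t, (starRingEnd ℂ)^[m] (F i) := by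
  induction m with
  | zero => rfl
  | succ m ih => simp only [Function.iterate_succ_apply', ih, map_sum]

theorem card_filter_cubeValue_le (d P K c : ℕ) (ω : Finset (Fin d)) :
    {n ∈ box d P | c ≤ cubeValue n.1 n.2 ω ∧ cubeValue n.1 n.2 ω < c + K}.card ≤ K * P ^ d := by
  rw [Finset.card_filter, box, Finset.sum_product_right]
  calc _ ≤ ∑ y ∈ Fintype.piFinset fun _ : Fin d => Finset.range P, K := by
        refine Finset.sum_le_sum fun y _ => ?_
        rw [← Finset.card_filter]
        calc _ ≤ (Finset.Ico (c - ∑ i ∈ ω, y i) (c + K - ∑ i ∈ ω, y i)).card := by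
              refine Finset.card_le_card fun x hx => ?_
              have h := (Finset.mem_filter.mp hx).2
              simp only [cubeValue] at h
              rw [Finset.mem_Ico]
              omega
          _ ≤ K := by rw [Nat.card_Ico]; omega
    _ = K * P ^ d := by simp [mul_comm]

section Basic

variable {k : ℕ} [NeZero k] {S G V : Type*} [Group G] [AddCommGroup V] [Module ℂ V]

open Classical in
/-- The contribution to a basic sequence of the integers whose leading part is `q`, if reading the
remaining digits from the state `δ(s₀, (q)_k)` leads to the state `t` with label `g`. -/
noncomputable def basicTerm (T : GroupExtAutomaton k S G) (ρ : Representation ℂ G V)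
    (α : Module.End ℂ V →ₗ[ℂ] ℂ) (s : S) (q : ℕ) (t : S) (g : G) : ℂ :=
  α (ρ (T.labelAt q * g)) * (if t = s then 1 else 0)

/-- The test function on carries, states and labels for the parallelepipeds with leading parts
`u_ω - |ω| M`, restricted to those with all leading parts in `[Q]`. -/
noncomputable def basicTest {d : ℕ} (T : GroupExtAutomaton k S G) (ρ : Representation ℂ G V)
    (α : Module.End ℂ V →ₗ[ℂ] ℂ) (s : S) (M Q : ℕ) (u : Finset (Fin d) → ℕ)
    (c : Finset (Fin d) → ℕ) (t : Finset (Fin d) → S) (g : Finset (Fin d) → G) : ℂ :=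
  ∏ ω : Finset (Fin d), (starRingEnd ℂ)^[ω.card]
    (if ω.card * M ≤ u ω + c ω ∧ u ω + c ω - ω.card * M < Q then
      basicTerm T ρ α s (u ω + c ω - ω.card * M) (t ω) (g ω) else 0)

variable {T : GroupExtAutomaton k S G} {ρ : Representation ℂ G V}
  {α : Module.End ℂ V →ₗ[ℂ] ℂ} {s : S}

theorem norm_basicTerm_le {B : ℝ} (hB : ∀ g, ‖α (ρ g)‖ ≤ B) (q : ℕ) (t : S) (g : G) :
    ‖basicTerm T ρ α s q t g‖ ≤ B := by
  have hB0 : 0 ≤ B := (norm_nonneg _).trans (hB 1)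
  rw [basicTerm]
  split_ifs
  · rw [mul_one]
    exact hB _
  · simpa using hB0

theorem norm_basicSequence_le {B : ℝ} (hB : ∀ g, ‖α (ρ g)‖ ≤ B) (n : ℕ) :
    ‖basicSequence T ρ α s n‖ ≤ B := by
  have hB0 : 0 ≤ B := (norm_nonneg _).trans (hB 1)
  rw [basicSequence]
  split_ifs
  · simpa using hB _
  · simpa using hB0

theorem norm_prod_iterate_star_le {d : ℕ} {B : ℝ} (F : Finset (Fin d) → ℂ) (hF : ∀ ω, ‖F ω‖ ≤ B) :
    ‖∏ ω : Finset (Fin d), (starRingEnd ℂ)^[ω.card] (F ω)‖ ≤ B ^ 2 ^ d := by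
  rw [norm_prod]
  calc _ ≤ ∏ _ω : Finset (Fin d), B :=
        Finset.prod_le_prod (fun _ _ => norm_nonneg _) fun ω _ => by
          rw [norm_iterate_star]; exact hF ω
    _ = _ := by simp

theorem sum_prod_mul_mulSingle_eq_zero {d : ℕ} {G₀ : Subgroup G} [Fintype G₀]
    (φ : Finset (Fin d) → G → ℂ) (hφ : ∀ x, ∑ h : G₀, φ Finset.univ (x * h) = 0)
    (g : Finset (Fin d) → G) : ∑ h : G₀, ∏ ω : Finset (Fin d), (starRingEnd ℂ)^[ω.card]
      (φ ω (g ω * Pi.mulSingle (M := fun _ => G) Finset.univ (h : G) ω)) = 0 := by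
  have hsplit : ∀ h : G₀, (∏ ω : Finset (Fin d), (starRingEnd ℂ)^[ω.card]
      (φ ω (g ω * Pi.mulSingle (M := fun _ => G) Finset.univ (h : G) ω))) =
      (starRingEnd ℂ)^[d] (φ Finset.univ (g Finset.univ * h)) *
        ∏ ω ∈ (Finset.univ : Finset (Finset (Fin d))).erase Finset.univ,
          (starRingEnd ℂ)^[ω.card] (φ ω (g ω)) := by
    intro h
    rw [← Finset.mul_prod_erase _ _ (Finset.mem_univ Finset.univ)]
    congr 1
    · simp
    · refine Finset.prod_congr rfl fun ω hω => ?_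
      rw [Pi.mulSingle_eq_of_ne (Finset.ne_of_mem_erase hω), mul_one]
  simp only [hsplit]
  rw [← Finset.sum_mul, ← iterate_star_sum, hφ, (iterate_star_eq_zero_iff _ _).mpr rfl, zero_mul]

theorem cancels_basicTest {d : ℕ} {G₀ : Subgroup G} [Fintype G₀]
    (hsum : ∑ h : G₀, ρ (h : G) = 0) (M Q : ℕ) (u : Finset (Fin d) → ℕ) :
    Cancels G₀ (basicTest T ρ α s M Q u) := by
  intro c t g
  refine sum_prod_mul_mulSingle_eq_zero (fun ω x =>
    if ω.card * M ≤ u ω + c ω ∧ u ω + c ω - ω.card * M < Q then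
      basicTerm T ρ α s (u ω + c ω - ω.card * M) (t ω) x else 0) (fun x => ?_) g
  split_ifs
  · simp only [basicTerm, ← mul_assoc, map_mul]
    rw [← Finset.sum_mul, ← map_sum, ← Finset.mul_sum, hsum, mul_zero, map_zero, zero_mul]
  · simp

theorem basicSequence_mul_pow_add (hk : 2 ≤ k) (hT : T.Prolongable) (q y L : ℕ) :
    basicSequence T ρ α s (q * k ^ L + y % k ^ L) =
      basicTerm T ρ α s q (T.run (T.stateAt q) (word k L y))
        (T.labelWord (T.stateAt q) (word k L y)) := by
  have hlt : y % k ^ L < k ^ L := Nat.mod_lt _ (Nat.pow_pos (by omega))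
  have hw : word k L (y % k ^ L) = word k L y := by
    conv_rhs => rw [← Nat.div_add_mod' y (k ^ L), word_mul_pow_add]
  have h1 := GroupExtAutomaton.stateAt_mul_pow_add hk hT q hlt
  have h2 := GroupExtAutomaton.labelAt_mul_pow_add hk hT q hlt
  rw [hw] at h1 h2
  rw [GroupExtAutomaton.stateAt] at h1
  rw [GroupExtAutomaton.labelAt] at h2
  rw [basicSequence, basicTerm, h1, h2]

/-- Away from the boundary of `[N]` at scale `k ^ L`, the cutoff is determined by leading parts. -/
theorem shifted_basicSequence {d : ℕ} (hk : 2 ≤ k) (hT : T.Prolongable) {N M L U y : ℕ}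
    {ω : Finset (Fin d)} (hbd : ¬ (ω.card * (M * k ^ L) ≤ U * k ^ L + y ∧
      (U * k ^ L + y - ω.card * (M * k ^ L)) / k ^ L = N / k ^ L)) :
    shifted N (M * k ^ L) (basicSequence T ρ α s) ω (U * k ^ L + y) =
      if ω.card * M ≤ U + y / k ^ L ∧ U + y / k ^ L - ω.card * M < N / k ^ L then
        basicTerm T ρ α s (U + y / k ^ L - ω.card * M)
          (T.run (T.stateAt (U + y / k ^ L - ω.card * M)) (word k L y))
          (T.labelWord (T.stateAt (U + y / k ^ L - ω.card * M)) (word k L y)) else 0 := by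
  have hK : 0 < k ^ L := Nat.pow_pos (by omega)
  rw [← basicSequence_mul_pow_add hk hT, shifted]
  set K := k ^ L
  have hmod : y % K < K := Nat.mod_lt _ hK
  have e1 : U * K + y = (U + y / K) * K + y % K := by
    rw [add_mul, add_assoc, Nat.div_add_mod']
  rw [e1] at hbd ⊢
  generalize U + y / K = c at hbd ⊢
  generalize y % K = R at hmod hbd ⊢
  rw [← mul_assoc] at hbd ⊢
  set m := ω.card * M
  by_cases hm : m ≤ c
  · obtain ⟨q, rfl⟩ := Nat.exists_eq_add_of_le hm
    have e2 : (m + q) * K + R - m * K = q * K + R := by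
      rw [add_mul]; omega
    have e3 : (q * K + R) / K = q := by
      rw [Nat.add_comm, Nat.add_mul_div_right _ _ hK, Nat.div_eq_of_lt hmod, zero_add]
    have hle : m * K ≤ (m + q) * K + R := by rw [add_mul]; omega
    rw [e2, e3] at hbd
    rw [e2, Nat.add_sub_cancel_left]
    have hiff : q * K + R < N ↔ q < N / K := by
      constructor
      · intro h
        have h1 : q ≤ N / K := by
          rw [Nat.le_div_iff_mul_le hK]; omega
        have h2 : q ≠ N / K := fun h => hbd ⟨hle, h⟩
        omega
      · intro h
        have h1 : (q + 1) * K ≤ N := (Nat.le_div_iff_mul_le hK).mp h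
        rw [add_mul, one_mul] at h1
        omega
    simp only [hle, hm, hiff, true_and]
  · have hle : ¬ m * K ≤ c * K + R := by
      intro h
      have : (c + 1) * K ≤ m * K := Nat.mul_le_mul_right _ (by omega)
      rw [add_mul, one_mul] at this
      omega
    rw [if_neg (fun h => hle h.1), if_neg (fun h => hm h.1)]

end Basic

section Estimate

variable {k : ℕ} [NeZero k] {S G V : Type*} [Group G] [AddCommGroup V] [Module ℂ V]
  {T : GroupExtAutomaton k S G} {ρ : Representation ℂ G V} {α : Module.End ℂ V →ₗ[ℂ] ℂ} {s : S}
  {d' : ℕ} {g₀ : G} {G₀ : Subgroup G}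

/-- The sum over parallelepipeds splits, according to the leading parts `u`, into sums over the `L`
lowest digits; the second term accounts for the parallelepipeds with a vertex at distance less than
`k ^ L` from the boundary of `[N]`. -/
theorem norm_cubeSum_basicSequence_le (hk : 2 ≤ k) (hT : T.Prolongable) {d : ℕ} {B E : ℝ}
    (hB : ∀ g, ‖α (ρ g)‖ ≤ B) (N M L : ℕ)
    (hE : ∀ (u : Finset (Fin d) → ℕ) (σ : (Finset (Fin d) → ℕ) → Finset (Fin d) → S),
      ‖blockSum T L (basicTest T ρ α s M (N / k ^ L) u) σ 0‖ ≤ E) :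
    ‖cubeSum d N (M * k ^ L) (basicSequence T ρ α s)‖ ≤
      (2 * M) ^ (d + 1) * E + 2 * B ^ 2 ^ d * (2 ^ d * (k ^ L * (2 * (M * k ^ L)) ^ d)) := by
  classical
  have hB0 : 0 ≤ B := (norm_nonneg _).trans (hB 1)
  have hK : 0 < k ^ L := Nat.pow_pos (by omega)
  set b := basicSequence T ρ α s
  set F : ℕ × (Fin d → ℕ) → ℂ := fun n => ∏ ω : Finset (Fin d),
    (starRingEnd ℂ)^[ω.card] (shifted N (M * k ^ L) b ω (cubeValue n.1 n.2 ω))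
  let σ : (Finset (Fin d) → ℕ) → (Finset (Fin d) → ℕ) → Finset (Fin d) → S :=
    fun u c ω => T.stateAt (u ω + c ω - ω.card * M)
  let Ψ : ℕ × (Fin d → ℕ) → ℕ × (Fin d → ℕ) → ℂ := fun u v =>
    basicTest T ρ α s M (N / k ^ L) (cubeValue u.1 u.2)
      (fun ω => (cubeValue v.1 v.2 ω + 0) / k ^ L)
      (fun ω => T.run (σ (cubeValue u.1 u.2) (fun ω => (cubeValue v.1 v.2 ω + 0) / k ^ L) ω)
        (word k L (cubeValue v.1 v.2 ω + 0)))
      (fun ω => T.labelWord (σ (cubeValue u.1 u.2) (fun ω => (cubeValue v.1 v.2 ω + 0) / k ^ L) ω)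
        (word k L (cubeValue v.1 v.2 ω + 0)))
  let bad : Finset (Fin d) → ℕ × (Fin d → ℕ) → Prop := fun ω n =>
    ω.card * (M * k ^ L) ≤ cubeValue n.1 n.2 ω ∧
      (cubeValue n.1 n.2 ω - ω.card * (M * k ^ L)) / k ^ L = N / k ^ L
  have hterm : ∀ q t g, ‖basicTerm T ρ α s q t g‖ ≤ B := norm_basicTerm_le hB
  have hbB : ∀ n, ‖b n‖ ≤ B := norm_basicSequence_le hB
  have hFB : ∀ n, ‖F n‖ ≤ B ^ 2 ^ d := by
    refine fun n => norm_prod_iterate_star_le _ fun ω => ?_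
    rw [shifted]
    split_ifs
    · exact hbB _
    · simpa using hB0
  have hΨB : ∀ u v, ‖Ψ u v‖ ≤ B ^ 2 ^ d := by
    refine fun u v => norm_prod_iterate_star_le _ fun ω => ?_
    split_ifs
    · exact hterm _ _ _
    · simpa using hB0
  let join : ℕ × (Fin d → ℕ) → ℕ × (Fin d → ℕ) → ℕ × (Fin d → ℕ) := fun u v =>
    (u.1 * k ^ L + v.1, fun i => u.2 i * k ^ L + v.2 i)
  have hgood : ∀ u v, (¬ ∃ ω, bad ω (join u v)) → F (join u v) = Ψ u v := by
    intro u v h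
    refine Finset.prod_congr rfl fun ω _ => ?_
    have hω : ¬ bad ω (join u v) := fun h' => h ⟨ω, h'⟩
    simp only [bad, join] at hω
    rw [cubeValue_mul_add] at hω
    simp only [join, σ, add_zero]
    rw [cubeValue_mul_add, shifted_basicSequence hk hT hω]
  have hdiff : ∀ u v, ‖F (join u v) - Ψ u v‖ ≤
      2 * B ^ 2 ^ d * (if ∃ ω, bad ω (join u v) then 1 else 0) := by
    intro u v
    split_ifs with h
    · calc _ ≤ ‖F (join u v)‖ + ‖Ψ u v‖ := norm_sub_le _ _
        _ ≤ B ^ 2 ^ d + B ^ 2 ^ d := add_le_add (hFB _) (hΨB _ _)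
        _ = _ := by ring
    · rw [hgood u v h]
      simp
  have hcount : ∑ n ∈ box d (2 * (M * k ^ L)), (if ∃ ω, bad ω n then (1 : ℝ) else 0) ≤
      2 ^ d * (k ^ L * (2 * (M * k ^ L)) ^ d) := by
    rw [Finset.sum_boole]
    have hsub : {n ∈ box d (2 * (M * k ^ L)) | ∃ ω, bad ω n} ⊆
        Finset.univ.biUnion fun ω : Finset (Fin d) => {n ∈ box d (2 * (M * k ^ L)) |
          ω.card * (M * k ^ L) + N / k ^ L * k ^ L ≤ cubeValue n.1 n.2 ω ∧
          cubeValue n.1 n.2 ω < ω.card * (M * k ^ L) + N / k ^ L * k ^ L + k ^ L} := by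
      intro n hn
      obtain ⟨hn1, ω, hω1, hω2⟩ := Finset.mem_filter.mp hn
      refine Finset.mem_biUnion.mpr ⟨ω, Finset.mem_univ _, Finset.mem_filter.mpr ⟨hn1, ?_⟩⟩
      have h1 := Nat.div_add_mod' (cubeValue n.1 n.2 ω - ω.card * (M * k ^ L)) (k ^ L)
      have h2 := Nat.mod_lt (cubeValue n.1 n.2 ω - ω.card * (M * k ^ L)) hK
      rw [hω2] at h1
      generalize (cubeValue n.1 n.2 ω - ω.card * (M * k ^ L)) % k ^ L = R at h1 h2
      omega
    have hle := (Finset.card_le_card hsub).trans (Finset.card_biUnion_le.trans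
      (Finset.sum_le_sum fun ω _ => card_filter_cubeValue_le d _ _ _ ω))
    rw [Finset.sum_const, Finset.card_univ, Fintype.card_finset, Fintype.card_fin,
      smul_eq_mul] at hle
    exact_mod_cast hle
  have hsplit : cubeSum d N (M * k ^ L) b =
      ∑ u ∈ box d (2 * M), ∑ v ∈ box d (k ^ L), Ψ u v +
      ∑ u ∈ box d (2 * M), ∑ v ∈ box d (k ^ L), (F (join u v) - Ψ u v) := by
    rw [cubeSum, ← mul_assoc, sum_box_mul, Finset.sum_comm, ← Finset.sum_add_distrib]
    refine Finset.sum_congr rfl fun u _ => ?_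
    rw [← Finset.sum_add_distrib]
    refine Finset.sum_congr rfl fun v _ => ?_
    rw [add_sub_cancel]
  rw [hsplit]
  refine (norm_add_le _ _).trans (add_le_add ?_ ?_)
  · calc _ ≤ ∑ u ∈ box d (2 * M), E :=
          norm_sum_le_of_le _ fun u _ => hE (cubeValue u.1 u.2) (σ (cubeValue u.1 u.2))
      _ = _ := by rw [Finset.sum_const, card_box, nsmul_eq_mul]; push_cast; ring
  · calc _ ≤ ∑ u ∈ box d (2 * M), ∑ v ∈ box d (k ^ L),
          2 * B ^ 2 ^ d * (if ∃ ω, bad ω (join u v) then 1 else 0) :=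
          norm_sum_le_of_le _ fun u _ => norm_sum_le_of_le _ fun v _ => hdiff u v
      _ = 2 * B ^ 2 ^ d *
          ∑ n ∈ box d (2 * (M * k ^ L)), (if ∃ ω, bad ω n then (1 : ℝ) else 0) := by
          rw [← mul_assoc 2 M, sum_box_mul d (2 * M) (k ^ L), Finset.sum_comm, Finset.mul_sum]
          refine Finset.sum_congr rfl fun u _ => ?_
          rw [Finset.mul_sum]
      _ ≤ _ := mul_le_mul_of_nonneg_left hcount (by positivity)

theorem isHighlyGowersUniform_basicSequence [Finite G] (hk : 2 ≤ k) (hT : IsEfficient T d' g₀ G₀)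
    (hirr : ρ.IsIrreducible) (hker : ¬ G₀ ≤ MonoidHom.ker ρ) :
    IsHighlyGowersUniform (basicSequence T ρ α s) := by
  have := Fintype.ofFinite G₀
  obtain ⟨B, hB1, hB⟩ : ∃ B : ℝ, 1 ≤ B ∧ ∀ g, ‖α (ρ g)‖ ≤ B := by
    obtain ⟨B, hB⟩ := (Set.finite_range fun g => ‖α (ρ g)‖).bddAbove
    exact ⟨max B 1, le_max_right _ _, fun g => (hB ⟨g, rfl⟩).trans (le_max_left _ _)⟩
  have hsum := sum_representation_eq_zero ρ hirr G₀ (hT.normal hk) hker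
  refine ⟨⟨B, norm_basicSequence_le hB⟩, fun d hd => ?_⟩
  obtain ⟨l, hl, hest⟩ := hT.exists_norm_blockSum_le hk hd
  obtain ⟨P, hP⟩ : ∃ P, P = k ^ l := ⟨_, rfl⟩
  rw [← hP] at hest
  have hP2 : 2 ≤ P := hP ▸ hk.trans (Nat.le_self_pow (by omega) k)
  have hPR : (2 : ℝ) ≤ P := by exact_mod_cast hP2
  have hD1 : 1 ≤ P ^ (d + 1) := Nat.one_le_pow _ _ (by omega)
  -- `θ` bounds the proportion of non-special blocks and the relative size of the boundary.
  set θ : ℝ := max (((P ^ (d + 1) - 1 : ℕ) : ℝ) / (P : ℝ) ^ (d + 1)) (1 / P) with hθ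
  have hθ0 : 0 < θ := lt_max_of_lt_right (by positivity)
  have hθ1 : θ < 1 := by
    refine max_lt ?_ ?_
    · rw [div_lt_one (by positivity), Nat.cast_sub hD1]
      push_cast
      linarith
    · rw [div_lt_one (by positivity)]
      linarith
  have hPsq : (1 : ℝ) < (P : ℝ) ^ 2 := by nlinarith
  set c : ℝ := -Real.logb ((P : ℝ) ^ 2) θ with hc
  have hc0 : 0 < c := neg_pos.mpr (Real.logb_neg hPsq hθ0 hθ1)
  set C₀ : ℝ := B ^ 2 ^ d with hC₀
  have hC₀0 : 0 ≤ C₀ := by positivity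
  set C₁ : ℝ := (4 * (d + 1)) ^ (d + 1) * (C₀ * (1 + 2 ^ (d + 1))) with hC₁
  have hC₁0 : 0 ≤ C₁ := by positivity
  refine ⟨c * ((1 : ℝ) / 2 ^ d), by positivity, (C₁ * θ⁻¹) ^ ((1 : ℝ) / 2 ^ d), fun N hN => ?_⟩
  have hNR : (1 : ℝ) ≤ N := by exact_mod_cast hN
  -- The blocks fill about half of the digits of `N`.
  set j := Nat.log (P ^ 2) N
  have hPsq' : 1 < P ^ 2 := by nlinarith
  have hj1 : (P ^ 2) ^ j ≤ N := Nat.pow_log_le_self _ (by omega)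
  have hj2 : N < (P ^ 2) ^ (j + 1) := Nat.lt_pow_succ_log_self hPsq' N
  set K := k ^ (l * j) with hK
  have hKP : K = P ^ j := by rw [hK, hP, pow_mul]
  have hKpos : 0 < K := Nat.pow_pos (by omega)
  have hKK : K * K ≤ N := by
    calc K * K = (P ^ 2) ^ j := by rw [hKP, ← mul_pow, ← pow_two]
      _ ≤ N := hj1
  set M := N / K + 1 with hM
  have hA1 : N ≤ M * K := by
    have h1 := Nat.div_add_mod' N K
    have h2 := Nat.mod_lt N hKpos
    rw [hM, add_mul, one_mul]
    omega
  have hA2 : M * K ≤ 2 * N := by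
    have h1 := Nat.div_mul_le_self N K
    have h2 : K ≤ K * K := Nat.le_mul_of_pos_left K hKpos
    rw [hM, add_mul, one_mul]
    omega
  have hmain := norm_cubeSum_basicSequence_le (s := s) (d := d) hk hT.idempotent.1 hB N M (l * j)
    (fun u σ => hest j _ C₀ (cancels_basicTest hsum M _ u)
      (fun c t g => norm_prod_iterate_star_le _ fun ω => by
        split_ifs
        · exact norm_basicTerm_le hB _ _ _
        · rw [norm_zero]; linarith) σ 0 fun _ => Nat.zero_le _)
  rw [← hK] at hmain
  have hAR : (2 * ((M : ℝ) * (k : ℝ) ^ (l * j))) ≤ 4 * N := by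
    have : ((M * K : ℕ) : ℝ) ≤ ((2 * N : ℕ) : ℝ) := Nat.cast_le.mpr hA2
    rw [hK] at this
    push_cast at this
    linarith
  have hKR : (k : ℝ) ^ (l * j) = (P : ℝ) ^ j := by rw [hP, pow_mul]; push_cast; rfl
  rw [hKR] at hmain hAR
  have hterm1 : (2 * (M : ℝ)) ^ (d + 1) * (((P ^ (d + 1) - 1 : ℕ) : ℝ) ^ j * C₀) ≤
      (4 * N) ^ (d + 1) * (C₀ * θ ^ j) := by
    have e : (2 * (M : ℝ)) ^ (d + 1) * (((P ^ (d + 1) - 1 : ℕ) : ℝ) ^ j * C₀) =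
        (2 * ((M : ℝ) * (P : ℝ) ^ j)) ^ (d + 1) *
          (C₀ * (((P ^ (d + 1) - 1 : ℕ) : ℝ) / (P : ℝ) ^ (d + 1)) ^ j) := by
      have hne : (P : ℝ) ≠ 0 := by positivity
      rw [div_pow, ← pow_mul, mul_comm (d + 1) j, pow_mul, ← mul_assoc 2, mul_pow (2 * (M : ℝ))]
      field_simp
    rw [e]
    gcongr
    exact le_max_left _ _
  have hterm2 : 2 * C₀ * (2 ^ d * ((P : ℝ) ^ j * (2 * ((M : ℝ) * (P : ℝ) ^ j)) ^ d)) ≤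
      (4 * N) ^ (d + 1) * (C₀ * 2 ^ (d + 1) * θ ^ j) := by
    have h1 : (P : ℝ) ^ j ≤ 4 * N * θ ^ j := by
      have h2 : (1 / (P : ℝ)) ^ j ≤ θ ^ j := by
        gcongr
        exact le_max_right _ _
      have h3 : (P : ℝ) ^ j * (P : ℝ) ^ j ≤ N := by
        rw [hKP] at hKK
        exact_mod_cast hKK
      calc (P : ℝ) ^ j = ((P : ℝ) ^ j * (P : ℝ) ^ j) * (1 / (P : ℝ)) ^ j := by
            rw [one_div, inv_pow, mul_assoc, mul_inv_cancel₀ (by positivity), mul_one]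
        _ ≤ N * θ ^ j := by gcongr
        _ ≤ 4 * N * θ ^ j := by
            have : 0 ≤ (N : ℝ) * θ ^ j := by positivity
            linarith
    calc _ ≤ 2 * C₀ * (2 ^ d * ((4 * N * θ ^ j) * (4 * N) ^ d)) := by gcongr
      _ = _ := by ring
  have hnum : ‖cubeSum d N (M * K) (basicSequence T ρ α s)‖ ≤
      (4 * N) ^ (d + 1) * (C₀ * (1 + 2 ^ (d + 1)) * θ ^ j) := by
    refine hmain.trans ((add_le_add hterm1 hterm2).trans (le_of_eq ?_))
    ring
  have hden := le_norm_cubeSum_one (d := d) hN hA1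
  have hdpos : 0 < ((N : ℝ) / (d + 1)) ^ (d + 1) := by positivity
  have hratio : ‖cubeSum d N (M * K) (basicSequence T ρ α s)‖ /
      ‖cubeSum d N (M * K) fun _ => 1‖ ≤ C₁ * θ ^ j := by
    rw [div_le_iff₀ (hdpos.trans_le hden)]
    calc _ ≤ (4 * N) ^ (d + 1) * (C₀ * (1 + 2 ^ (d + 1)) * θ ^ j) := hnum
      _ = C₁ * θ ^ j * ((N : ℝ) / (d + 1)) ^ (d + 1) := by
          rw [hC₁, div_pow, mul_pow, mul_pow]
          field_simp
      _ ≤ _ := by gcongr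
  have hpow : θ ^ j ≤ θ⁻¹ * (N : ℝ) ^ (-c) := by
    have h1 : (((P : ℝ) ^ 2) ^ (j + 1)) ^ (-c) = θ ^ (j + 1) := by
      rw [← Real.rpow_natCast ((P : ℝ) ^ 2), ← Real.rpow_mul (by positivity), mul_comm,
        Real.rpow_mul (by positivity), Real.rpow_natCast, hc, neg_neg,
        Real.rpow_logb (by positivity) hPsq.ne' hθ0]
    have h2 : (((P : ℝ) ^ 2) ^ (j + 1)) ^ (-c) ≤ (N : ℝ) ^ (-c) :=
      Real.rpow_le_rpow_of_nonpos (by linarith) (by exact_mod_cast hj2.le) (by linarith)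
    rw [h1] at h2
    calc θ ^ j = θ⁻¹ * θ ^ (j + 1) := by rw [pow_succ']; field_simp
      _ ≤ _ := by gcongr
  rw [gowersNormInterval_eq hd hA1]
  calc _ ≤ (C₁ * θ⁻¹ * (N : ℝ) ^ (-c)) ^ ((1 : ℝ) / 2 ^ d) := by
        refine Real.rpow_le_rpow (by positivity) (hratio.trans ?_) (by positivity)
        exact (mul_le_mul_of_nonneg_left hpow hC₁0).trans_eq (mul_assoc _ _ _).symm
    _ = _ := by
        rw [Real.mul_rpow (by positivity) (by positivity), ← Real.rpow_mul (by positivity), neg_mul]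

end Estimate

end AutSeq

theorem mainTheorem6 {k : ℕ} [NeZero k] (hk : 2 ≤ k)
    {S G V : Type*} [Finite S] [Group G] [Finite G]
    (T : GroupExtAutomaton k S G) (d' : ℕ) (g₀ : G) (G₀ : Subgroup G)
    (hT : IsEfficient T d' g₀ G₀)
    [NormedAddCommGroup V] [InnerProductSpace ℂ V] [FiniteDimensional ℂ V]
    (ρ : Representation ℂ G V) (hρ : IsUnitaryRep ρ) (hirr : ρ.IsIrreducible)
    (α : Module.End ℂ V →ₗ[ℂ] ℂ) (s : S) :
    (G₀ ≤ MonoidHom.ker ρ → IsStronglyStructured k (basicSequence T ρ α s)) ∧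
    (¬ G₀ ≤ MonoidHom.ker ρ → IsHighlyGowersUniform (basicSequence T ρ α s)) := by
  exact ⟨isStronglyStructured_basicSequence hk hT ρ α s,
    isHighlyGowersUniform_basicSequence hk hT hirr⟩
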